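/- Let $\Gamma$ be a (possibly infinite) group, let $\Gamma_1$ be a normal subgroup of $\Gamma$, and let $\mathcal{A}$ be a set of subgroups of $\Gamma$ such that every non-identity element of $\Gamma$ lies in exactly one member of the set $\{\Gamma_1\}\cup\mathcal{A}$, each $A\in\mathcal{A}$ is malnormal (that is, $\gamma^{-1}A\gamma\cap A=\{1\}$ for all $\gamma\in\Gamma\setminus A$), and every conjugate of each $A\in\mathcal{A}$ is in $\mathcal{A}$. Let $G$ be a graph (finite or infinite, loops and parallel edges allowed) with a $\Gamma$-gain function $\psi$, that is, a function from the oriented edges $(e,u,v)$ of $G$ (where $e$ is an edge with ends $u,v$) to $\Gamma$ with $\psi(e,u,v)=\psi(e,v,u)^{-1}$ whenever $u\neq v$. The gain of a walk is the product, in order, of the gains of its oriented edges, and a cycle of $G$ is $\psi$-balanced if some simple closed walk around it has gain $1$. Write $\psi/\Gamma_1$ for the composition of $\psi$ with $\Gamma\to\Gamma/\Gamma_1$. For $\eta\colon V(G)\to\Gamma$ put $\psi^{\eta}(e,u,v)=\eta(u)^{-1}\psi(e,u,v)\eta(v)$, and for a set $X$ of edges let $\psi^{\eta}(X)$ be the set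 of values of $\psi^\eta$ at all orientations of edges in $X$. A tight handcuff is the union of two edge-disjoint cycles with exactly one common vertex; a loose handcuff is the union of two vertex-disjoint cycles and a minimal path connecting them; a theta graph is the union of three paths between two distinct vertices which pairwise share no edge and no vertex other than these two ends. (Cycles, handcuffs and theta graphs of $G$ are identified with their edge sets.) Then there is a unique matroid $F(G,\psi/\Gamma_1)$ on $E(G)$, the frame matroid, whose circuits are exactly the $(\psi/\Gamma_1)$-balanced cycles together with the handcuffs and theta graphs that contain no $(\psi/\Gamma_1)$-balanced cycle. Let $\mathcal{C}=\mathcal{C}(\Gamma,\Gamma_1,\mathcal{A},G,\psi)$ be the set of those circuits $C$ of $F=F(G,\psi/\Gamma_1)$ such that either $C$ is a $\psi$-balanced cycle, or $C$ is a handcuff or a theta graph and there are $\eta\colon V(G)\to\Gamma$ and $A\in\mathcal{A}$ with $\psi^{\eta}(C)\subseteq A$. Then: 1. $\mathcal{C}$ is a linear class of circuits of $F$: if $C_1,C_2\in\mathcal{C}$ and $|C_1\cup C_2|-r_F(C_1\cup C_2)=2$, then every circuit of $F$ contained in $C_1\cup C_2$ is in $\mathcal{C}$. 2. There is a unique matroid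 $M=M(\Gamma,\Gamma_1,\mathcal{A},G,\psi)$ on $E(G)$ (all of whose circuits are finite, if $E(G)$ is infinite) such that, for all $X\subseteq E(G)$, $r_M(X)=r_F(X)$ if every circuit of $F$ contained in $X$ is in $\mathcal{C}$, and $r_M(X)=r_F(X)+1$ otherwise. It is an elementary lift of $F$: there is a matroid $K$ on $E(G)\cup\{e\}$, with $e\notin E(G)$, such that $K\setminus e=M$ and $K/e=F$. -/

import Mathlib

namespace GainGraph

universe u v w

variable {α : Type u} {β : Type v}

/-! ### Walks, cycles, theta graphs and handcuffs in a multigraph (loops and parallel edges allowed) -/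

/-- Walks `x₀, e₁, x₁, …, eₖ, xₖ` of a graph, indexed by their first and last vertex. -/
inductive Walk (G : Graph α β) : α → α → Type (max u v)
  | nil (x : α) (hx : x ∈ G.vertexSet) : Walk G x x
  | cons {x y z : α} (e : β) (h : G.IsLink e x y) (p : Walk G y z) : Walk G x z

namespace Walk

variable {G : Graph α β}

/-- The list of edges traversed by a walk. -/
def edges : {x y : α} → Walk G x y → List β
  | _, _, nil _ _ => []
  | _, _, cons e _ p => e :: p.edges

/-- The list of vertices `x₀, x₁, …, xₖ` visited by a walk. -/
def support : {x y : α} → Walk G x y → List α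
  | _, _, nil x _ => [x]
  | x, _, cons _ _ p => x :: p.support

/-- The set of edges of a walk. -/
def edgeSet {x y : α} (p : Walk G x y) : Set β := {e | e ∈ p.edges}

/-- A path is a walk without repeated vertices. -/
def IsPath {x y : α} (p : Walk G x y) : Prop := p.support.Nodup

/-- A simple closed walk: a closed walk with at least one edge, which repeats no edge, and
no vertex except that the first one is also the last one. A loop is such a walk
of length one, and two parallel edges give such a walk of length two. -/
def IsSimpleClosed {x : α} (p : Walk G x x) : Prop :=
  p.edges ≠ [] ∧ p.edges.Nodup ∧ p.support.tail.Nodup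

end Walk

/-- `C` is (the edge set of) a cycle of `G`. -/
def IsCycle (G : Graph α β) (C : Set β) : Prop :=
  ∃ (x : α) (p : Walk G x x), p.IsSimpleClosed ∧ C = p.edgeSet

/-- `C` is the edge set of a theta graph: three paths between two distinct vertices which
pairwise share no edge and no vertex other than the two ends. -/
def IsTheta (G : Graph α β) (C : Set β) : Prop :=
  ∃ (x y : α) (p : Fin 3 → Walk G x y), x ≠ y ∧ (∀ i, (p i).IsPath) ∧
    (∀ i j, i ≠ j → (p i).edges.Disjoint (p j).edges ∧
      ∀ z, z ∈ (p i).support → z ∈ (p j).support → z = x ∨ z = y) ∧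
    C = ⋃ i, (p i).edgeSet

/-- `C` is the edge set of a tight handcuff: two edge-disjoint cycles with exactly one
common vertex. -/
def IsTightHandcuff (G : Graph α β) (C : Set β) : Prop :=
  ∃ (x : α) (p q : Walk G x x), p.IsSimpleClosed ∧ q.IsSimpleClosed ∧
    p.edges.Disjoint q.edges ∧ (∀ z, z ∈ p.support → z ∈ q.support → z = x) ∧
    C = p.edgeSet ∪ q.edgeSet

/-- `C` is the edge set of a loose handcuff: two vertex-disjoint cycles together with a path
between them which meets each of the two cycles only in an end of the path. -/
def IsLooseHandcuff (G : Graph α β) (C : Set β) : Prop :=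
  ∃ (x y : α) (p : Walk G x x) (q : Walk G y y) (r : Walk G x y),
    p.IsSimpleClosed ∧ q.IsSimpleClosed ∧ r.IsPath ∧
    p.support.Disjoint q.support ∧
    (∀ z, z ∈ r.support → z ∈ p.support → z = x) ∧
    (∀ z, z ∈ r.support → z ∈ q.support → z = y) ∧
    C = p.edgeSet ∪ r.edgeSet ∪ q.edgeSet

/-- `C` is the edge set of a handcuff (tight or loose) or of a theta graph. -/
def IsHandcuffOrTheta (G : Graph α β) (C : Set β) : Prop :=
  IsTightHandcuff G C ∨ IsLooseHandcuff G C ∨ IsTheta G C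

/-! ### Gain functions -/

/-- A `Γ`-gain function on `G`. The oriented edges of `G` are the triples `(e, x, y)` with
`G.IsLink e x y`; the values of `gain` at other triples are never used. A loop
`e` at `x` has the single oriented edge `(e, x, x)`, whose value is arbitrary. -/
structure GainFunction (G : Graph α β) (Γ : Type w) [Group Γ] where
  gain : β → α → α → Γ
  gain_symm : ∀ e x y, G.IsLink e x y → x ≠ y → gain e x y = (gain e y x)⁻¹

namespace GainFunction

variable {G : Graph α β} {Γ : Type w} [Group Γ]

/-- The gain of a walk: the product, in order, of the gains of its oriented edges. -/
def walkGain (ψ : GainFunction G Γ) : {x y : α} → Walk G x y → Γ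
  | _, _, Walk.nil _ _ => 1
  | x, _, Walk.cons (y := y) e _ p => ψ.gain e x y * ψ.walkGain p

/-- `C` is a `ψ`-balanced cycle. -/
def IsBalancedCycle (ψ : GainFunction G Γ) (C : Set β) : Prop :=
  ∃ (x : α) (p : Walk G x x), p.IsSimpleClosed ∧ C = p.edgeSet ∧ ψ.walkGain p = 1

/-- The set of `ψ`-balanced cycles. -/
def balancedCycles (ψ : GainFunction G Γ) : Set (Set β) := {C | ψ.IsBalancedCycle C}

/-- The gain function obtained from `ψ` by the switching function `η`. -/
def switch (ψ : GainFunction G Γ) (η : α → Γ) : GainFunction G Γ where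
  gain e x y := (η x)⁻¹ * ψ.gain e x y * η y
  gain_symm e x y h hxy := by
    rw [ψ.gain_symm e x y h hxy]
    group

/-- The gain function `ψ/Γ₁` with values in the quotient group `Γ ⧸ Γ₁`. -/
def quotient (ψ : GainFunction G Γ) (Γ₁ : Subgroup Γ) [Γ₁.Normal] :
    GainFunction G (Γ ⧸ Γ₁) where
  gain e x y := (ψ.gain e x y : Γ ⧸ Γ₁)
  gain_symm e x y h hxy := by
    rw [ψ.gain_symm e x y h hxy]
    rfl

/-- The set `ψ(X)` of all gain values of the orientations of the edges in `X`. -/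
def values (ψ : GainFunction G Γ) (X : Set β) : Set Γ :=
  {g | ∃ e ∈ X, ∃ x y, G.IsLink e x y ∧ g = ψ.gain e x y}

end GainFunction

/-! ### Frame matroids -/

/-- The circuits of the frame matroid of a graph `G` with a set `B` of balanced cycles: the
balanced cycles, and the handcuffs and theta graphs all of whose cycles are unbalanced. -/
def IsFrameCircuit (G : Graph α β) (B : Set (Set β)) (C : Set β) : Prop :=
  C ∈ B ∨ (IsHandcuffOrTheta G C ∧ ∀ D ⊆ C, IsCycle G D → D ∉ B)

/-- `F` is the frame matroid of `(G, ψ)`: the matroid on the edge set of `G` with the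
circuits just described, for the `ψ`-balanced cycles. (A matroid is determined by its ground
set and its circuits.) -/
def IsFrameMatroid {G : Graph α β} {Γ : Type w} [Group Γ] (ψ : GainFunction G Γ)
    (F : Matroid β) : Prop :=
  F.E = G.edgeSet ∧ ∀ C, F.IsCircuit C ↔ IsFrameCircuit G ψ.balancedCycles C

/-! ### Linear classes of circuits and elementary lifts -/

/-- `𝒞` is a linear class of circuits of `M`: all its members are circuits, and for every
modular pair `C₁`, `C₂` of members, that is, with `|C₁ ∪ C₂| - r(C₁ ∪ C₂) = 2`,
every circuit contained in `C₁ ∪ C₂` is a member. -/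
def IsLinearClass (M : Matroid β) (𝒞 : Set (Set β)) : Prop :=
  (∀ C ∈ 𝒞, M.IsCircuit C) ∧
    ∀ C₁ ∈ 𝒞, ∀ C₂ ∈ 𝒞, (C₁ ∪ C₂).encard = M.eRk (C₁ ∪ C₂) + 2 →
      ∀ C ⊆ C₁ ∪ C₂, M.IsCircuit C → C ∈ 𝒞

/-- `M'` is an elementary lift of `M`: there is a matroid `K` with an element `e` (here `none`)
such that `K` with `e` deleted is `M'` and `K` with `e` contracted is `M`. -/
def IsElementaryLift (M' M : Matroid β) : Prop :=
  ∃ K : Matroid (Option β), none ∈ K.E ∧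
    K.delete {none} = M'.mapEmbedding Function.Embedding.some ∧
    K.contract {none} = M.mapEmbedding Function.Embedding.some

/-- `M'` is the matroid that is associated with `M` and the set `𝒞` of circuits of `M`: it has
the same ground set, and `X` has the rank `r(X)` it has in `M` if every circuit of `M` contained
in `X` is in `𝒞`, and the rank `r(X) + 1` otherwise. The condition that `M'` be finitary holds
automatically when the ground set is finite; in general it makes `M'` unique. -/
def IsLiftAlong (M : Matroid β) (𝒞 : Set (Set β)) (M' : Matroid β) : Prop :=
  M'.E = M.E ∧ M'.Finitary ∧
    (∀ X ⊆ M.E, (∀ C ⊆ X, M.IsCircuit C → C ∈ 𝒞) → M'.eRk X = M.eRk X) ∧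
    (∀ X ⊆ M.E, ¬ (∀ C ⊆ X, M.IsCircuit C → C ∈ 𝒞) → M'.eRk X = M.eRk X + 1)

/-! ### Frobenius partitions and the linear class -/

/-- A subgroup `A` is malnormal if `γ⁻¹ A γ ∩ A` is trivial for every `γ ∉ A`. -/
def IsMalnormal {Γ : Type w} [Group Γ] (A : Subgroup Γ) : Prop :=
  ∀ γ : Γ, γ ∉ A → A.map (MulAut.conj γ⁻¹).toMonoidHom ⊓ A = ⊥

/-- `{Γ₁} ∪ 𝒜` is a Frobenius partition of `Γ`: `Γ₁` is normal, every non-identity element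
lies in exactly one of the subgroups in `{Γ₁} ∪ 𝒜`, and each `A ∈ 𝒜` is malnormal and
has all its conjugates in `𝒜`. -/
structure IsFrobeniusPartition {Γ : Type w} [Group Γ] (Γ₁ : Subgroup Γ)
    (𝒜 : Set (Subgroup Γ)) : Prop where
  normal : Γ₁.Normal
  partition : ∀ g : Γ, g ≠ 1 → ∃! H : Subgroup Γ, H ∈ insert Γ₁ 𝒜 ∧ g ∈ H
  malnormal : ∀ A ∈ 𝒜, IsMalnormal A
  conj_mem : ∀ A ∈ 𝒜, ∀ γ : Γ, A.map (MulAut.conj γ).toMonoidHom ∈ 𝒜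

/-- The set `𝒞(Γ, Γ₁, 𝒜, G, ψ)`: the circuits of the frame matroid of `(G, ψ/Γ₁)` which are
`ψ`-balanced cycles, or which are handcuffs or theta graphs whose gain values, after some
switching, all lie in some `A ∈ 𝒜`. -/
def linearClass {G : Graph α β} {Γ : Type w} [Group Γ] (Γ₁ : Subgroup Γ) [Γ₁.Normal]
    (𝒜 : Set (Subgroup Γ)) (ψ : GainFunction G Γ) : Set (Set β) :=
  {C | IsFrameCircuit G (ψ.quotient Γ₁).balancedCycles C ∧
    (ψ.IsBalancedCycle C ∨
      (IsHandcuffOrTheta G C ∧ ∃ η : α → Γ, ∃ A ∈ 𝒜, (ψ.switch η).values C ⊆ (A : Set Γ)))}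

end GainGraph

/-! Let an edge with gain `g` from `u` to `v` impose on labellings `x` of the vertices by a `Γ`-set
the equation `x u = g • x v`. Two `Γ`-sets matter. The set `T` is `Γ ⧸ Γ₁` with a fixed zero added,
so it sees gains only modulo `Γ₁`. The set `S` consists of the nontrivial members of `𝒜` other than
`Γ₁`, under conjugation, together with two free orbits. Malnormality makes each such member of `𝒜`
its own stabilizer, so by the partition property a non-identity element fixes exactly one point of
`S` if it lies outside `Γ₁`, and none if it lies in `Γ₁`. The model case is the affine group of a
field, with `Γ₁` the translations: labellings in `T` then resemble solutions of a homogeneous linear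
system, and labellings in `S` those of an inhomogeneous one.

On the edges and one more element `none`, a closure operator collects the elements satisfied by all
solutions in both sets, where `none` counts as satisfied in `T` and violated in `S`. The main point
is its exchange property (`IsFramePair.hasExchange`): if a solution can be varied at one vertex,
then the walks between two given vertices of that component all act alike, and the value at that
vertex may be chosen freely. This gives a finitary matroid `K`.

The closure of `K` with `none` contracted is defined by `T` alone, and a study of its independent
sets shows that it is the frame matroid `F` (`IsSolMatroid.isCircuit_iff`). Further, `none` lies in
the closure of a finite `X` exactly if `X` has no solution in `S`. The labels of such a solution on
a handcuff or theta circuit form part of one orbit, so switching moves all gains into one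
stabilizer. Hence `𝒞` consists of the circuits of `F` which do not span `none` in `K`
(`mem_linearClass_iff`). The linear class property, the rank formula and the elementary lift are
then general facts about deleting and contracting `none`. -/

namespace Matroid

open Set

variable {ε : Type*}

/-! ### Finitary matroids from closure operators with exchange -/

/-- A set is independent for a closure operator if no element lies in the closure of the others. -/
def ClosureIndep (c : ClosureOperator (Set ε)) (I : Set ε) : Prop := ∀ e ∈ I, e ∉ c (I \ {e})

/-- The exchange property of a closure operator. -/
def HasExchange (c : ClosureOperator (Set ε)) : Prop :=
  ∀ X e f, f ∈ c (insert e X) → f ∉ c X → e ∈ c (insert f X)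

section Closure

variable {c : ClosureOperator (Set ε)}

lemma ClosureIndep.subset {I J : Set ε} (hJ : ClosureIndep c J) (h : I ⊆ J) : ClosureIndep c I :=
  fun e he hc ↦ hJ e (h he) (c.monotone (sdiff_subset_sdiff_left h) hc)

lemma ClosureIndep.insert_of_notMem (hc : HasExchange c) {I : Set ε} {e : ε} (hI : ClosureIndep c I)
    (he : e ∉ c I) : ClosureIndep c (insert e I) := by
  have heI : e ∉ I := fun h ↦ he (c.le_closure I h)
  intro f hf hfc
  rcases eq_or_ne f e with rfl | hfe
  · exact he (by simpa [heI] using hfc)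
  · have hfI : f ∈ I := by simpa [hfe] using hf
    have h1 : insert e I \ {f} = insert e (I \ {f}) := by
      rw [insert_sdiff_of_notMem]; simpa using hfe.symm
    rw [h1] at hfc
    have := hc _ _ _ hfc (hI f hfI)
    rw [insert_sdiff_singleton, insert_eq_of_mem hfI] at this
    exact he this

lemma closureIndep_empty : ClosureIndep c ((∅ : Finset ε) : Set ε) := by
  intro e he
  simp at he

lemma closure_subset_of_subset {X Y : Set ε} (h : X ⊆ c Y) : c X ⊆ c Y :=
  ClosureOperator.le_closure_iff.1 h

/-- Steinitz exchange: for `j ∈ J \ I`, some `i ∈ I` avoids the closure of `J \ {j}`, as otherwise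
that closure would contain `c I` and hence `j`. Replacing `j` by `i` keeps `J` independent and of
the same size, and brings it closer to `I`. -/
lemma ClosureIndep.ncard_le (hc : HasExchange c) {I J : Set ε} (hI : I.Finite) (hJ : J.Finite)
    (hJi : ClosureIndep c J) (hJI : J ⊆ c I) : J.ncard ≤ I.ncard := by
  induction hn : (J \ I).ncard generalizing J with
  | zero =>
    rw [ncard_eq_zero hJ.sdiff, sdiff_eq_empty] at hn
    exact ncard_le_ncard hn hI
  | succ n ih =>
    obtain ⟨j, hjJ, hjI⟩ : (J \ I).Nonempty := by
      rw [nonempty_iff_ne_empty]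
      intro h
      simp [h] at hn
    obtain ⟨i, hiI, hi⟩ : ∃ i ∈ I, i ∉ c (J \ {j}) := by
      by_contra! h
      exact hJi j hjJ (closure_subset_of_subset h (hJI hjJ))
    have hiJ : i ∉ J \ {j} := fun h ↦ hi (c.le_closure _ h)
    have h1 := (hJi.subset sdiff_subset).insert_of_notMem hc hi
    have h2 := ih (J := Insert.insert i (J \ {j})) (hJ.sdiff.insert i) h1
      (insert_subset (c.le_closure _ hiI) (sdiff_subset.trans hJI)) ?_
    · rwa [ncard_insert_of_notMem hiJ hJ.sdiff, ncard_sdiff_singleton_add_one hjJ hJ] at h2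
    · have h3 : Insert.insert i (J \ {j}) \ I = (J \ I) \ {j} := by
        rw [insert_sdiff_of_mem _ hiI]; ext; simp; tauto
      rw [h3, ncard_sdiff_singleton_of_mem (show j ∈ J \ I from ⟨hjJ, hjI⟩), hn,
        Nat.add_sub_cancel]

/-- A closure operator with the exchange property gives rise to a finitary matroid, whose closure
agrees with the given one on finite sets. -/
lemma exists_finitary_of_closure (hc : HasExchange c) (E : Set ε) (hE : ∀ e ∉ E, e ∈ c ∅) :
    ∃ M : Matroid ε, M.E = E ∧ M.Finitary ∧ ∀ X ⊆ E, X.Finite → M.closure X = c X ∩ E := by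
  classical
  -- Elements outside `E` are loops of `c`, so independent sets avoid them.
  have hsub : ∀ I : Set ε, ClosureIndep c I → I ⊆ E := by
    intro I hI e he
    by_contra h
    exact hI e he (c.monotone (empty_subset _) (hE e h))
  have haug : ∀ ⦃I J : Finset ε⦄, ClosureIndep c (I : Set ε) → ClosureIndep c (J : Set ε) →
      I.card < J.card → ∃ e ∈ J, e ∉ I ∧ ClosureIndep c ((insert e I : Finset ε) : Set ε) := by
    intro I J hI hJ hIJ
    by_contra! h
    refine hIJ.not_ge ?_
    have := hJ.ncard_le hc I.finite_toSet J.finite_toSet (fun j hj ↦ ?_)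
    · simpa [ncard_coe_finset] using this
    · by_contra hjI
      have hjI' : j ∉ I := fun h ↦ hjI (c.le_closure _ (by simpa using h))
      refine h j (by simpa using hj) hjI' ?_
      simpa using hI.insert_of_notMem hc hjI
  have hmono : ∀ ⦃I J : Finset ε⦄, ClosureIndep c (J : Set ε) → I ⊆ J →
      ClosureIndep c (I : Set ε) := fun I J hJ h ↦ hJ.subset (by exact_mod_cast h)
  -- The operator `c` need not be finitary, so only its finite independent sets are used; an
  -- infinite set is declared independent if all its finite subsets are.
  obtain ⟨N, hNE, hN⟩ : ∃ N : Matroid ε, N.E = E ∧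
      ∀ I, N.Indep I ↔ ∀ J : Finset ε, (J : Set ε) ⊆ I → ClosureIndep c (J : Set ε) :=
    ⟨(IndepMatroid.ofFinset E (fun I : Finset ε ↦ ClosureIndep c (I : Set ε))
      closureIndep_empty hmono haug (fun I hI ↦ hsub _ hI)).matroid, rfl,
      fun I ↦ IndepMatroid.ofFinset_indep' E _ closureIndep_empty hmono haug
        (fun I hI ↦ hsub _ hI)⟩
  have hind : ∀ I : Set ε, I.Finite → (N.Indep I ↔ ClosureIndep c I) := by
    intro I hI
    obtain ⟨I, rfl⟩ := hI.exists_finset_coe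
    rw [hN]
    exact ⟨fun h ↦ h _ Subset.rfl, fun h J hJ ↦ h.subset hJ⟩
  subst hNE
  refine ⟨N, rfl, ⟨fun I hI ↦ ?_⟩, ?_⟩
  · rw [hN]
    intro J hJ
    rw [← hind _ J.finite_toSet]
    exact hI _ hJ J.finite_toSet
  · intro X hX hXf
    obtain ⟨I, hI⟩ := N.exists_isBasis X hX
    have hIf := hXf.subset hI.subset
    have hIi := (hind _ hIf).1 hI.indep
    have key : ∀ e ∈ N.E, e ∈ N.closure I ↔ e ∈ c I := by
      intro e he
      rw [← not_iff_not, hI.indep.notMem_closure_iff he, hind _ (hIf.insert e)]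
      refine ⟨fun h ↦ ?_, fun h ↦ ⟨hIi.insert_of_notMem hc h, fun h' ↦ h (c.le_closure _ h')⟩⟩
      have := h.1 e (mem_insert _ _)
      simpa [h.2] using this
    have hXI : X ⊆ c I := fun x hx ↦ (key x (hX hx)).1 (hI.subset_closure hx)
    have hcX : c X = c I :=
      (closure_subset_of_subset hXI).antisymm (c.monotone hI.subset)
    rw [← hI.closure_eq_closure, hcX]
    ext e
    refine ⟨fun h ↦ ?_, fun h ↦ (key e h.2).2 h.1⟩
    have he : e ∈ N.E := N.closure_subset_ground _ h
    exact ⟨(key e he).1 h, he⟩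

end Closure

/-! ### Deleting and contracting one element: elementary lifts -/

lemma mapEmbedding_comap {β : Type*} (N : Matroid β) (f : ε ↪ β) (h : N.E ⊆ range f) :
    (N.comap f).mapEmbedding f = N := by
  refine ext_indep (by simpa [image_preimage_eq_iff] using h) fun I hI ↦ ?_
  have hI' : I ⊆ range f := hI.trans (by simp [image_preimage_eq_inter_range])
  rw [mapEmbedding_indep_iff, comap_indep_iff, image_preimage_eq_iff.2 hI']
  simp [hI', f.injective.injOn]

/-- The matroid on `ε` obtained by contracting the element `none`. -/
def contractNone (K : Matroid (Option ε)) : Matroid ε := (K ／ {none}).comap some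

/-- The matroid on `ε` obtained by deleting the element `none`. -/
def deleteNone (K : Matroid (Option ε)) : Matroid ε := (K ＼ {none}).comap some

section Lift

variable {K : Matroid (Option ε)}

lemma contractNone_mapEmbedding :
    K.contractNone.mapEmbedding Function.Embedding.some = K ／ {none} := by
  refine mapEmbedding_comap _ Function.Embedding.some ?_
  rintro (_ | x) hx
  · simp at hx
  · exact ⟨x, rfl⟩

lemma deleteNone_mapEmbedding :
    K.deleteNone.mapEmbedding Function.Embedding.some = K ＼ {none} := by
  refine mapEmbedding_comap _ Function.Embedding.some ?_
  rintro (_ | x) hx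
  · simp at hx
  · exact ⟨x, rfl⟩

lemma contractNone_ground : K.contractNone.E = some ⁻¹' K.E := by
  ext; simp [contractNone]

lemma deleteNone_ground : K.deleteNone.E = some ⁻¹' K.E := by
  ext; simp [deleteNone]

lemma deleteNone_indep_iff {I : Set ε} : K.deleteNone.Indep I ↔ K.Indep (some '' I) := by
  simp [deleteNone, (Option.some_injective ε).injOn]

lemma contractNone_indep_iff (h : K.IsNonloop none) {I : Set ε} :
    K.contractNone.Indep I ↔ K.Indep (insert none (some '' I)) := by
  simp [contractNone, (Option.some_injective ε).injOn, h.contractElem_indep_iff]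

lemma mem_contractNone_closure_iff {X : Set ε} {e : ε} :
    e ∈ K.contractNone.closure X ↔ some e ∈ K.closure (insert none (some '' X)) := by
  simp [contractNone, contract_closure_eq]

lemma eRk_deleteNone (X : Set ε) : K.deleteNone.eRk X = K.eRk (some '' X) := by
  rw [deleteNone, eRk_comap, delete_eq_restrict, restrict_eRk_eq', ← K.eRk_inter_ground (_ '' X)]
  congr 1
  ext (_ | x) <;> simp

lemma eRk_contractNone_add_one (h : K.IsNonloop none) {X : Set ε} (hX : X ⊆ K.contractNone.E) :
    K.contractNone.eRk X + 1 = K.eRk (insert none (some '' X)) := by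
  have hX' : some '' X ⊆ (K ／ {none}).E := by
    rintro _ ⟨x, hx, rfl⟩
    have := hX hx
    simpa [contractNone_ground] using this
  obtain ⟨I, hI⟩ := (K ／ {none}).exists_isBasis _ hX'
  have h1 := h.indep.union_isBasis_union_of_contract_isBasis hI
  have hn : none ∉ I := fun hn ↦ by simpa using hI.subset hn
  rw [contractNone, eRk_comap, hI.eRk_eq_encard, ← encard_insert_of_notMem hn, insert_eq,
    union_comm, ← h1.encard_eq_eRk.symm, insert_eq, union_comm]

lemma deleteNone_finitary [K.Finitary] : K.deleteNone.Finitary := by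
  unfold deleteNone; infer_instance

lemma contractNone_finitary [K.Finitary] : K.contractNone.Finitary := by
  unfold contractNone; infer_instance

open GainGraph

/-- Here and in the next lemma the two ranks are compared through the rank in `K` of `X` with `none`
added, which always exceeds the rank in the contraction by one. -/
lemma eRk_deleteNone_of_notMem_closure (h : K.IsNonloop none) {X : Set ε}
    (hX : X ⊆ K.contractNone.E) (hn : none ∉ K.closure (some '' X)) :
    K.deleteNone.eRk X = K.contractNone.eRk X := by
  have h1 := eRk_contractNone_add_one h hX
  rw [eRk_insert_eq_add_one ⟨h.mem_ground, hn⟩] at h1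
  rw [eRk_deleteNone]
  exact (ENat.add_left_injective_of_ne_top (by simp) h1).symm

lemma eRk_deleteNone_of_mem_closure (h : K.IsNonloop none) {X : Set ε}
    (hX : X ⊆ K.contractNone.E) (hn : none ∈ K.closure (some '' X)) :
    K.deleteNone.eRk X = K.contractNone.eRk X + 1 := by
  rw [eRk_contractNone_add_one h hX, eRk_deleteNone, ← K.eRk_closure_eq (insert _ _),
    closure_insert_eq_of_mem_closure hn, eRk_closure_eq]

lemma contractNone_dep_of_deleteNone_dep (h : K.IsNonloop none) {X : Set ε}
    (hX : K.deleteNone.Dep X) : K.contractNone.Dep X := by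
  refine ⟨fun hi ↦ hX.not_indep ?_, ?_⟩
  · rw [deleteNone_indep_iff]
    exact ((contractNone_indep_iff h).1 hi).subset (subset_insert _ _)
  · have := hX.subset_ground
    rwa [deleteNone_ground, ← contractNone_ground] at this

variable {𝒞 : Set (Set ε)}

/-- Since `C` has the same rank in both matroids, it remains dependent after deletion; it is minimal
because sets dependent in the deletion are dependent in the contraction. -/
lemma deleteNone_isCircuit (h : K.IsNonloop none) {C : Set ε} (hC : K.contractNone.IsCircuit C)
    (hn : none ∉ K.closure (some '' C)) (hfin : C.Finite) : K.deleteNone.IsCircuit C := by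
  have hd : K.deleteNone.Dep C := by
    refine ⟨fun hi ↦ ?_, ?_⟩
    · have h1 := eRk_deleteNone_of_notMem_closure h hC.subset_ground hn
      rw [hi.eRk_eq_encard, ← hC.eRk_add_one_eq] at h1
      have h2 : K.contractNone.eRk C ≠ ⊤ :=
        ne_top_of_le_ne_top hfin.encard_lt_top.ne (K.contractNone.eRk_le_encard C)
      revert h1 h2
      generalize K.contractNone.eRk C = n
      intro h1 h2
      lift n to ℕ using h2
      norm_cast at h1
      omega
    · rw [deleteNone_ground, ← contractNone_ground]
      exact hC.subset_ground
  obtain ⟨D, hDC, hD⟩ := hd.exists_isCircuit_subset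
  rwa [← hC.eq_of_dep_subset (contractNone_dep_of_deleteNone_dep h hD.dep) hDC]

lemma isLinearClass_contractNone [K.Finitary] (h : K.IsNonloop none)
    (h𝒞 : ∀ C, C ∈ 𝒞 ↔ K.contractNone.IsCircuit C ∧ none ∉ K.closure (some '' C)) :
    IsLinearClass K.contractNone 𝒞 := by
  have hfin : K.contractNone.Finitary := contractNone_finitary
  refine ⟨fun C hC ↦ ((h𝒞 C).1 hC).1, fun C₁ hC₁ C₂ hC₂ hr C hC hCc ↦ (h𝒞 C).2 ⟨hCc, ?_⟩⟩
  obtain ⟨hc₁, hn₁⟩ := (h𝒞 C₁).1 hC₁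
  obtain ⟨hc₂, hn₂⟩ := (h𝒞 C₂).1 hC₂
  have hf₁ := hc₁.finite
  have hf₂ := hc₂.finite
  -- If the union spanned `none`, its rank in the deletion would be `|C₁ ∪ C₂| - 1`. There `C₁` and
  -- `C₂` are distinct circuits, so `C₁ ∩ C₂` is independent, and submodularity fails by one.
  suffices hn : none ∉ K.closure (some '' (C₁ ∪ C₂)) from
    fun hn' ↦ hn (K.closure_subset_closure (image_mono hC) hn')
  intro hn
  have hr1 := eRk_deleteNone_of_mem_closure h (union_subset hc₁.subset_ground hc₂.subset_ground) hn
  have hd₁ := deleteNone_isCircuit h hc₁ hn₁ hf₁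
  have hd₂ := deleteNone_isCircuit h hc₂ hn₂ hf₂
  have hne : C₁ ≠ C₂ := by
    rintro rfl
    rw [union_self, ← hc₁.eRk_add_one_eq] at hr
    have h2 : K.contractNone.eRk C₁ ≠ ⊤ :=
      ne_top_of_le_ne_top hf₁.encard_lt_top.ne (K.contractNone.eRk_le_encard C₁)
    revert hr h2
    generalize K.contractNone.eRk C₁ = n
    intro h1 h2
    lift n to ℕ using h2
    norm_cast at h1
    omega
  have hi : K.deleteNone.Indep (C₁ ∩ C₂) := by
    refine hd₁.ssubset_indep (inter_subset_left.ssubset_of_ne fun he ↦ hne ?_)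
    exact hd₁.eq_of_subset_isCircuit hd₂ (inter_eq_left.1 he)
  have hsm := K.deleteNone.eRk_inter_add_eRk_union_le C₁ C₂
  rw [hi.eRk_eq_encard, hr1] at hsm
  have e1 := hd₁.eRk_add_one_eq
  have e2 := hd₂.eRk_add_one_eq
  have e3 := encard_union_add_encard_inter C₁ C₂
  rw [hr, ← e1, ← e2] at e3
  have t1 := ne_top_of_le_ne_top hf₁.encard_lt_top.ne (K.deleteNone.eRk_le_encard C₁)
  have t2 := ne_top_of_le_ne_top hf₂.encard_lt_top.ne (K.deleteNone.eRk_le_encard C₂)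
  have t3 := ne_top_of_le_ne_top (hf₁.union hf₂).encard_lt_top.ne
    (K.contractNone.eRk_le_encard (C₁ ∪ C₂))
  have t4 := (hf₁.inter_of_left C₂).encard_lt_top.ne
  revert hsm e3 t1 t2 t3 t4
  generalize K.deleteNone.eRk C₁ = a
  generalize K.deleteNone.eRk C₂ = b
  generalize K.contractNone.eRk (C₁ ∪ C₂) = c
  generalize (C₁ ∩ C₂).encard = d
  intro hsm e3 t1 t2 t3 t4
  lift a to ℕ using t1
  lift b to ℕ using t2
  lift c to ℕ using t3
  lift d to ℕ using t4
  norm_cast at hsm e3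
  omega

lemma forall_isCircuit_mem_iff (h : K.IsNonloop none)
    (h𝒞 : ∀ C, C ∈ 𝒞 ↔ K.contractNone.IsCircuit C ∧ none ∉ K.closure (some '' C)) (X : Set ε) :
    (∀ C ⊆ X, K.contractNone.IsCircuit C → C ∈ 𝒞) ↔ none ∉ K.closure (some '' X) := by
  constructor
  · intro hX hn
    -- A circuit `D` of `K` through `none` loses `none` to become a circuit of the contraction; that
    -- circuit spans `none`, so it is not in `𝒞`.
    obtain ⟨D, hDX, hD, hnD⟩ := exists_isCircuit_of_mem_closure hn (by simp)
    have hDi : insert none (some '' (some ⁻¹' D)) = D := by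
      ext (_ | x) <;> simp [hnD]
    have hDi' : D \ {none} = some '' (some ⁻¹' D) := by
      ext (_ | x) <;> simp
    have hcl : none ∈ K.closure (some '' (some ⁻¹' D)) :=
      hDi' ▸ hD.mem_closure_sdiff_singleton_of_mem hnD
    have hdep : K.contractNone.Dep (some ⁻¹' D) := by
      refine ⟨fun hi ↦ hD.not_indep ?_, ?_⟩
      · rwa [contractNone_indep_iff h, hDi] at hi
      · rw [contractNone_ground]
        exact preimage_mono hD.subset_ground
    obtain ⟨C, hCD, hC⟩ := hdep.exists_isCircuit_subset
    have hCeq : C = some ⁻¹' D := by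
      refine hCD.antisymm fun x hx ↦ ?_
      have h1 : ¬ K.Indep (insert none (some '' C)) := by
        rw [← contractNone_indep_iff h]
        exact hC.not_indep
      have h2 : insert none (some '' C) ⊆ D := by
        rw [← hDi]
        exact insert_subset_insert (image_mono hCD)
      have h3 := hD.eq_of_not_indep_subset h1 h2
      have h4 : some x ∈ insert none (some '' C) := h3 ▸ hx
      simpa using h4
    have hCX : C ⊆ X := by
      intro x hx
      have h1 : some x ∈ D := hCD hx
      have := hDX h1
      simpa using this
    exact ((h𝒞 C).1 (hX C hCX hC)).2 (hCeq ▸ hcl)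
  · intro hn C hCX hC
    exact (h𝒞 C).2 ⟨hC, fun hn' ↦ hn (K.closure_subset_closure (image_mono hCX) hn')⟩

lemma isLiftAlong_deleteNone [K.Finitary] (h : K.IsNonloop none)
    (h𝒞 : ∀ C, C ∈ 𝒞 ↔ K.contractNone.IsCircuit C ∧ none ∉ K.closure (some '' C)) :
    IsLiftAlong K.contractNone 𝒞 K.deleteNone := by
  refine ⟨by rw [deleteNone_ground, contractNone_ground], deleteNone_finitary, ?_, ?_⟩
  · intro X hX hC
    exact eRk_deleteNone_of_notMem_closure h hX ((forall_isCircuit_mem_iff h h𝒞 X).1 hC)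
  · intro X hX hC
    rw [forall_isCircuit_mem_iff h h𝒞 X, not_not] at hC
    exact eRk_deleteNone_of_mem_closure h hX hC

lemma isElementaryLift_deleteNone (h : K.IsNonloop none) :
    IsElementaryLift K.deleteNone K.contractNone :=
  ⟨K, h.mem_ground, deleteNone_mapEmbedding.symm, contractNone_mapEmbedding.symm⟩

end Lift

open GainGraph in
-- The prescribed ranks decide which finite sets are independent, and a finitary matroid is
-- determined by these.
lemma IsLiftAlong.unique {F M M' : Matroid ε} {𝒞 : Set (Set ε)} (h : IsLiftAlong F 𝒞 M)
    (h' : IsLiftAlong F 𝒞 M') : M' = M := by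
  obtain ⟨hE, hf, hg, hb⟩ := h
  obtain ⟨hE', hf', hg', hb'⟩ := h'
  refine ext_indep (hE'.trans hE.symm) fun I hI ↦ ?_
  have key : ∀ J ⊆ I, M'.eRk J = M.eRk J := by
    intro J hJ
    have hJF : J ⊆ F.E := hE' ▸ hJ.trans hI
    by_cases h : ∀ C ⊆ J, F.IsCircuit C → C ∈ 𝒞
    · rw [hg' J hJF h, hg J hJF h]
    · rw [hb' J hJF h, hb J hJF h]
  rw [indep_iff_forall_finite_subset_indep, indep_iff_forall_finite_subset_indep (M := M)]
  refine forall₃_congr fun J hJ hJf ↦ ?_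
  rw [indep_iff_eRk_eq_encard_of_finite hJf, indep_iff_eRk_eq_encard_of_finite hJf, key J hJ]

end Matroid

namespace GainGraph

universe u v w

variable {α : Type u} {β : Type v} {G : Graph α β}

/-! ### Walks, paths and simple closed walks -/

namespace Walk

variable {x y z : α}

lemma start_mem : ∀ {x y : α} (p : Walk G x y), x ∈ p.support
  | _, _, nil _ _ => by simp [support]
  | _, _, cons _ _ _ => by simp [support]

lemma end_mem : ∀ {x y : α} (p : Walk G x y), y ∈ p.support
  | _, _, nil _ _ => by simp [support]
  | _, _, cons _ _ p => by simp [support, p.end_mem]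

lemma support_eq_cons : ∀ {x y : α} (p : Walk G x y), p.support = x :: p.support.tail
  | _, _, nil _ _ => by simp [support]
  | _, _, cons _ _ _ => by simp [support]

/-- The concatenation of two walks. -/
def append : {x y z : α} → Walk G x y → Walk G y z → Walk G x z
  | _, _, _, nil _ _, q => q
  | _, _, _, cons e h p, q => cons e h (p.append q)

@[simp] lemma edges_append : ∀ {x y z : α} (p : Walk G x y) (q : Walk G y z),
    (p.append q).edges = p.edges ++ q.edges
  | _, _, _, nil _ _, q => by simp [append, edges]
  | _, _, _, cons e h p, q => by simp [append, edges, edges_append p q]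

lemma support_append : ∀ {x y z : α} (p : Walk G x y) (q : Walk G y z),
    (p.append q).support = p.support ++ q.support.tail
  | _, _, _, nil x _, q => by
    simp only [append, support, List.singleton_append]; exact q.support_eq_cons
  | _, _, _, cons e h p, q => by simp [append, support, support_append p q]

lemma mem_support_append {p : Walk G x y} {q : Walk G y z} {w : α} :
    w ∈ (p.append q).support ↔ w ∈ p.support ∨ w ∈ q.support := by
  rw [support_append, List.mem_append]
  constructor
  · rintro (h | h)
    · exact .inl h
    · exact .inr (List.mem_of_mem_tail h)
  · rintro (h | h)
    · exact .inl h
    · rw [q.support_eq_cons, List.mem_cons] at h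
      rcases h with rfl | h
      · exact .inl p.end_mem
      · exact .inr h

/-- The reverse of a walk. -/
def reverse : {x y : α} → Walk G x y → Walk G y x
  | _, _, nil x hx => nil x hx
  | x, _, cons e h p => p.reverse.append (cons e h.symm (nil x h.left_mem))

@[simp] lemma edges_reverse : ∀ {x y : α} (p : Walk G x y), p.reverse.edges = p.edges.reverse
  | _, _, nil _ _ => by simp [reverse, edges]
  | _, _, cons e h p => by simp [reverse, edges, edges_reverse p]

@[simp] lemma support_reverse : ∀ {x y : α} (p : Walk G x y),
    p.reverse.support = p.support.reverse
  | _, _, nil _ _ => by simp [reverse, support]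
  | _, _, cons e h p => by simp [reverse, support, support_append, support_reverse p]

lemma IsPath.reverse {p : Walk G x y} (hp : p.IsPath) : p.reverse.IsPath := by
  simpa [IsPath] using hp

lemma edgeSet_reverse (p : Walk G x y) : p.reverse.edgeSet = p.edgeSet := by
  simp [edgeSet]

lemma edgeSet_append (p : Walk G x y) (q : Walk G y z) :
    (p.append q).edgeSet = p.edgeSet ∪ q.edgeSet := by
  ext; simp [edgeSet]

lemma edgeSet_cons (e : β) (h : G.IsLink e x y) (p : Walk G y z) :
    (cons e h p).edgeSet = insert e p.edgeSet := by
  ext; simp [edgeSet, edges]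

lemma finite_edgeSet (p : Walk G x y) : p.edgeSet.Finite := p.edges.finite_toSet

lemma left_mem_support : ∀ {x y : α} {p : Walk G x y} {e : β} {u v : α}, e ∈ p.edges →
    G.IsLink e u v → u ∈ p.support
  | _, _, nil _ _, e, u, v, he, h => by simp [edges] at he
  | _, _, cons f hf p, e, u, v, he, h => by
    simp only [edges, List.mem_cons] at he
    simp only [support, List.mem_cons]
    rcases he with rfl | he
    · rcases h.left_eq_or_eq hf with rfl | rfl
      · exact .inl rfl
      · exact .inr p.start_mem
    · exact .inr (left_mem_support he h)

lemma right_mem_support {p : Walk G x y} {e : β} {u v : α} (he : e ∈ p.edges)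
    (h : G.IsLink e u v) : v ∈ p.support := left_mem_support he h.symm

lemma exists_isLink : ∀ {x y : α} {p : Walk G x y} {e : β}, e ∈ p.edges → ∃ u v, G.IsLink e u v
  | _, _, nil _ _, e, he => by simp [edges] at he
  | x, _, cons (y := y) f hf p, e, he => by
    simp only [edges, List.mem_cons] at he
    rcases he with rfl | he
    · exact ⟨_, _, hf⟩
    · exact exists_isLink he

lemma edgeSet_subset (p : Walk G x y) : p.edgeSet ⊆ G.edgeSet := by
  intro e he
  obtain ⟨u, v, h⟩ := exists_isLink (p := p) he
  exact h.edge_mem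

lemma exists_eq_append_of_mem_support : ∀ {x y : α} (p : Walk G x y) {w : α}, w ∈ p.support →
    ∃ (a : Walk G x w) (b : Walk G w y), p = a.append b
  | _, _, nil x hx, w, hw => by
    simp only [support, List.mem_singleton] at hw
    subst hw
    exact ⟨nil w hx, nil w hx, rfl⟩
  | x, _, cons e h p, w, hw => by
    simp only [support, List.mem_cons] at hw
    rcases hw with rfl | hw
    · exact ⟨nil w h.left_mem, cons e h p, rfl⟩
    · obtain ⟨a, b, rfl⟩ := exists_eq_append_of_mem_support p hw
      exact ⟨cons e h a, b, rfl⟩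

lemma exists_eq_append_of_mem_edges : ∀ {x y : α} (p : Walk G x y) {f : β}, f ∈ p.edges →
    ∃ (c d : α) (h : G.IsLink f c d) (a : Walk G x c) (b : Walk G d y), p = a.append (cons f h b)
  | _, _, nil x hx, f, hf => by simp [edges] at hf
  | x, _, cons e h p, f, hf => by
    simp only [edges, List.mem_cons] at hf
    rcases em (f = e) with rfl | hne
    · exact ⟨_, _, h, nil x h.left_mem, p, rfl⟩
    · obtain ⟨c, d, hl, a, b, rfl⟩ := exists_eq_append_of_mem_edges p (hf.resolve_left hne)
      exact ⟨c, d, hl, cons e h a, b, rfl⟩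

lemma isPath_cons {e : β} {h : G.IsLink e x y} {p : Walk G y z} :
    (cons e h p).IsPath ↔ x ∉ p.support ∧ p.IsPath := by
  simp [IsPath, support]

lemma isPath_append {p : Walk G x y} {q : Walk G y z} :
    (p.append q).IsPath ↔ p.IsPath ∧ q.IsPath ∧ ∀ w ∈ p.support, w ∈ q.support → w = y := by
  unfold IsPath
  rw [support_append, List.nodup_append]
  have hq := q.support_eq_cons
  constructor
  · rintro ⟨h1, h2, h3⟩
    have hy : y ∉ q.support.tail := fun hy ↦ h3 y p.end_mem y hy rfl
    refine ⟨h1, by rw [hq]; exact List.nodup_cons.2 ⟨hy, h2⟩, fun w hw hw' ↦ ?_⟩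
    rw [hq, List.mem_cons] at hw'
    rcases hw' with rfl | hw'
    · rfl
    · exact absurd rfl (h3 w hw w hw')
  · rintro ⟨h1, h2, h3⟩
    rw [hq, List.nodup_cons] at h2
    refine ⟨h1, h2.2, fun a ha b hb hab ↦ ?_⟩
    subst hab
    have := h3 a ha (List.mem_of_mem_tail hb)
    subst this
    exact h2.1 hb

lemma IsPath.nodup_edges : ∀ {x y : α} {p : Walk G x y}, p.IsPath → p.edges.Nodup
  | _, _, nil _ _, _ => by simp [edges]
  | _, _, cons e h p, hp => by
    rw [isPath_cons] at hp
    simp only [edges, List.nodup_cons]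
    exact ⟨fun he ↦ hp.1 (left_mem_support he h), hp.2.nodup_edges⟩

lemma IsPath.eq_nil {p : Walk G x x} (hp : p.IsPath) : p.edges = [] := by
  cases p with
  | nil => rfl
  | cons e h p => exact absurd p.end_mem (isPath_cons.1 hp).1

lemma edges_ne_nil {p : Walk G x y} (h : x ≠ y) : p.edges ≠ [] := by
  cases p with
  | nil => exact absurd rfl h
  | cons e h p => simp [edges]

lemma isSimpleClosed_cons {e : β} {h : G.IsLink e x y} {q : Walk G y x} :
    (cons e h q).IsSimpleClosed ↔ e ∉ q.edges ∧ q.IsPath := by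
  simp only [IsSimpleClosed, edges, support, List.tail_cons, List.nodup_cons, IsPath]
  constructor
  · rintro ⟨-, h1, h2⟩
    exact ⟨h1.1, h2⟩
  · rintro ⟨h1, h2⟩
    exact ⟨by simp, ⟨h1, IsPath.nodup_edges h2⟩, h2⟩

lemma IsSimpleClosed.exists_eq_cons {p : Walk G x x} (hp : p.IsSimpleClosed) :
    ∃ (y : α) (e : β) (h : G.IsLink e x y) (q : Walk G y x), p = cons e h q ∧ e ∉ q.edges ∧
      q.IsPath := by
  cases p with
  | nil => exact absurd rfl hp.1
  | cons e h q => exact ⟨_, e, h, q, rfl, isSimpleClosed_cons.1 hp⟩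

lemma isSimpleClosed_append {p : Walk G x y} {q : Walk G y x} (hpq : p.edges ++ q.edges ≠ []) :
    (p.append q).IsSimpleClosed ↔ (p.edges ++ q.edges).Nodup ∧
      (p.support.tail ++ q.support.tail).Nodup := by
  rw [IsSimpleClosed, edges_append, support_append, p.support_eq_cons]
  simp [hpq]

lemma exists_rotate {p : Walk G x x} (hp : p.IsSimpleClosed) {w : α} (hw : w ∈ p.support) :
    ∃ q : Walk G w w, q.IsSimpleClosed ∧ q.edgeSet = p.edgeSet ∧
      ∀ z, z ∈ q.support ↔ z ∈ p.support := by
  obtain ⟨a, b, rfl⟩ := p.exists_eq_append_of_mem_support hw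
  have hne := hp.1
  rw [edges_append] at hne
  have hne' : b.edges ++ a.edges ≠ [] := by
    simpa [and_comm] using hne
  rw [isSimpleClosed_append hne] at hp
  refine ⟨b.append a, (isSimpleClosed_append hne').2 ⟨?_, ?_⟩, ?_, fun z ↦ ?_⟩
  · exact List.perm_append_comm.nodup_iff.1 hp.1
  · exact List.perm_append_comm.nodup_iff.1 hp.2
  · rw [edgeSet_append, edgeSet_append, Set.union_comm]
  · rw [mem_support_append, mem_support_append, or_comm]

/-- Two internally disjoint paths between distinct vertices form a cycle. -/
lemma exists_isSimpleClosed_of_isPath {p q : Walk G x y} (hxy : x ≠ y) (hp : p.IsPath)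
    (hq : q.IsPath) (hd : p.edges.Disjoint q.edges)
    (hs : ∀ z, z ∈ p.support → z ∈ q.support → z = x ∨ z = y) :
    ∃ c : Walk G x x, c.IsSimpleClosed ∧ c.edgeSet = p.edgeSet ∪ q.edgeSet ∧
      ∀ z, z ∈ c.support ↔ z ∈ p.support ∨ z ∈ q.support := by
  have hne : p.edges ++ q.reverse.edges ≠ [] := by simp [edges_ne_nil hxy]
  refine ⟨p.append q.reverse, (isSimpleClosed_append hne).2 ⟨?_, ?_⟩, ?_, fun z ↦ ?_⟩
  · rw [List.nodup_append]
    refine ⟨hp.nodup_edges, hq.reverse.nodup_edges, fun a ha b hb hab ↦ ?_⟩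
    subst hab
    exact hd ha (by simpa using hb)
  · have hp' := hp
    have hq' := hq.reverse
    unfold IsPath at hp' hq'
    rw [support_eq_cons, List.nodup_cons] at hp' hq'
    rw [List.nodup_append]
    refine ⟨hp'.2, hq'.2, fun a ha b hb hab ↦ ?_⟩
    subst hab
    have h1 : a ∈ q.support := by simpa using List.mem_of_mem_tail hb
    rcases hs a (List.mem_of_mem_tail ha) h1 with rfl | rfl
    · exact hp'.1 ha
    · exact hq'.1 hb
  · rw [edgeSet_append, edgeSet_reverse]
  · rw [mem_support_append]; simp

end Walk

variable {Γ : Type w} [Group Γ]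

/-! ### Labellings of the vertices by `Γ`-sets -/

namespace GainFunction

variable {P : Type*} [MulAction Γ P] {ψ : GainFunction G Γ}

/-- A labelling of the vertices by elements of a `Γ`-set is compatible with the edge `e` if the
gain of `e` maps the label of the head of `e` to the label of its tail. -/
def Sat (ψ : GainFunction G Γ) (x : α → P) (e : β) : Prop :=
  ∀ u v, G.IsLink e u v → x u = ψ.gain e u v • x v

/-- A labelling which is compatible with all the edges in `X`. -/
def IsSol (ψ : GainFunction G Γ) (X : Set β) (x : α → P) : Prop := ∀ e ∈ X, ψ.Sat x e

/-- The reverse orientation carries the inverse gain and gives the same equation; a loop has only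
one orientation. -/
lemma sat_iff {x : α → P} {e : β} {u v : α} (h : G.IsLink e u v) :
    ψ.Sat x e ↔ x u = ψ.gain e u v • x v := by
  refine ⟨fun hs ↦ hs u v h, fun hx u' v' h' ↦ ?_⟩
  rcases h.eq_and_eq_or_eq_and_eq h' with ⟨rfl, rfl⟩ | ⟨rfl, rfl⟩
  · exact hx
  · rcases eq_or_ne u v with rfl | hne
    · exact hx
    · rw [ψ.gain_symm e v u h' hne.symm, hx, inv_smul_smul]

lemma exists_isLink_of_not_sat {x : α → P} {e : β} (h : ¬ ψ.Sat x e) : ∃ u v, G.IsLink e u v := by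
  unfold Sat at h
  push Not at h
  obtain ⟨u, v, h, -⟩ := h
  exact ⟨u, v, h⟩

lemma isSol_mono {X Y : Set β} {x : α → P} (h : ψ.IsSol Y x) (hXY : X ⊆ Y) : ψ.IsSol X x :=
  fun e he ↦ h e (hXY he)

lemma isSol_insert {X : Set β} {e : β} {x : α → P} :
    ψ.IsSol (insert e X) x ↔ ψ.Sat x e ∧ ψ.IsSol X x := by
  simp [IsSol]

lemma isSol_union {X Y : Set β} {x : α → P} :
    ψ.IsSol (X ∪ Y) x ↔ ψ.IsSol X x ∧ ψ.IsSol Y x := by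
  simp only [IsSol, Set.mem_union, or_imp, forall_and]

lemma IsSol.eq_walkGain_smul {X : Set β} {x : α → P} (hx : ψ.IsSol X x) :
    ∀ {u v : α} (p : Walk G u v), p.edgeSet ⊆ X → x u = ψ.walkGain p • x v
  | _, _, .nil _ _, _ => by simp [walkGain]
  | _, _, .cons e h p, hp => by
    rw [Walk.edgeSet_cons, Set.insert_subset_iff] at hp
    rw [walkGain, mul_smul, ← hx.eq_walkGain_smul p hp.2]
    exact hx e hp.1 _ _ h

/-- A solution can be changed to take a prescribed value at a vertex `u`, without changing it
outside the component of `u`. -/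
lemma IsSol.exists_transport {X : Set β} {w : α → P} (hw : ψ.IsSol X w) {u : α}
    (hu : u ∈ G.vertexSet) {s : P} (hs : ∀ (a : α) (p p' : Walk G a u), p.edgeSet ⊆ X →
      p'.edgeSet ⊆ X → ψ.walkGain p • s = ψ.walkGain p' • s) :
    ∃ x : α → P, ψ.IsSol X x ∧ x u = s ∧
      ∀ a, (¬ ∃ p : Walk G a u, p.edgeSet ⊆ X) → x a = w a := by
  classical
  set x : α → P := fun a ↦ if h : ∃ p : Walk G a u, p.edgeSet ⊆ X then
    ψ.walkGain h.choose • s else w a with hx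
  have hxp : ∀ {a : α} (p : Walk G a u), p.edgeSet ⊆ X → x a = ψ.walkGain p • s := by
    intro a p hp
    have h : ∃ p : Walk G a u, p.edgeSet ⊆ X := ⟨p, hp⟩
    simp only [hx, dif_pos h]
    exact hs _ _ _ h.choose_spec hp
  refine ⟨x, fun e he a b hab ↦ ?_, ?_, fun a ha ↦ by simp only [hx, dif_neg ha]⟩
  · by_cases h : ∃ p : Walk G b u, p.edgeSet ⊆ X
    · obtain ⟨p, hp⟩ := h
      rw [hxp p hp, hxp (.cons e hab p) (by
        rw [Walk.edgeSet_cons]; exact Set.insert_subset he hp), walkGain, mul_smul]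
    · have h' : ¬ ∃ p : Walk G a u, p.edgeSet ⊆ X := by
        rintro ⟨p, hp⟩
        exact h ⟨.cons e hab.symm p, by rw [Walk.edgeSet_cons]; exact Set.insert_subset he hp⟩
      simp only [hx, dif_neg h, dif_neg h']
      exact hw e he a b hab
  · simpa [walkGain] using hxp (.nil u hu) (by simp [Walk.edgeSet, Walk.edges])

/-- A group action where an element which fixes two points fixes every point. -/
def FixesAtMostOne (Γ : Type w) [Group Γ] (P : Type*) [MulAction Γ P] : Prop :=
  ∀ (g : Γ) (s t : P), s ≠ t → g • s = s → g • t = t → ∀ r : P, g • r = r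

lemma FixesAtMostOne.smul_eq_smul (hP : FixesAtMostOne Γ P) {g h : Γ} {s t : P} (hst : s ≠ t)
    (hs : g • s = h • s) (ht : g • t = h • t) (r : P) : g • r = h • r := by
  have := hP (h⁻¹ * g) s t hst (by rw [mul_smul, hs, inv_smul_smul])
    (by rw [mul_smul, ht, inv_smul_smul]) r
  rwa [mul_smul, inv_smul_eq_iff] at this

/-- The exchange property for the closure defined by the solutions in a `Γ`-set. -/
lemma sat_of_exchange (hP : FixesAtMostOne Γ P) {X : Set β} {e f : β} {y z : α → P}
    (hy : ψ.IsSol X y) (hyf : ψ.Sat y f) (hye : ¬ ψ.Sat y e)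
    (hz : ψ.IsSol X z) (hze : ψ.Sat z e)
    (hf : ∀ x : α → P, ψ.IsSol X x → ψ.Sat x e → ψ.Sat x f) {w : α → P} (hw : ψ.IsSol X w) :
    ψ.Sat w f := by
  by_contra hwf
  obtain ⟨a, b, hab⟩ := exists_isLink_of_not_sat hwf
  obtain ⟨u₀, v₀, huv₀⟩ := exists_isLink_of_not_sat hye
  -- Only one of `y`, `z` satisfies `e`, so they differ at an end of `e`.
  obtain ⟨u, v, huv, hyz⟩ : ∃ u v, G.IsLink e u v ∧ y u ≠ z u := by
    by_contra! h
    have h1 := h _ _ huv₀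
    have h2 := h _ _ huv₀.symm
    rw [sat_iff huv₀, h1, h2, ← sat_iff huv₀] at hye
    exact hye hze
  -- Parallel walks act alike on the distinct points `y u` and `z u`, hence on all of `P`. So every
  -- value at `u` extends over the component of `u` in `X`.
  have htr : ∀ (c : α) (p p' : Walk G c u), p.edgeSet ⊆ X → p'.edgeSet ⊆ X →
      ∀ s : P, ψ.walkGain p • s = ψ.walkGain p' • s := by
    intro c p p' hp hp' s
    refine hP.smul_eq_smul hyz ?_ ?_ s
    · rw [← hy.eq_walkGain_smul p hp, ← hy.eq_walkGain_smul p' hp']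
    · rw [← hz.eq_walkGain_smul p hp, ← hz.eq_walkGain_smul p' hp']
  -- solutions of `X` which agree with `w` outside the component of `u` and satisfy `e`
  obtain ⟨s, hs⟩ : ∃ s : (α → P) → P, ∀ w : α → P, ψ.IsSol X w → ∀ x : α → P, ψ.IsSol X x →
      x u = s w → (∀ c, (¬ ∃ p : Walk G c u, p.edgeSet ⊆ X) → x c = w c) → ψ.Sat x e := by
    by_cases hv : ∃ p : Walk G v u, p.edgeSet ⊆ X
    · obtain ⟨p, hp⟩ := hv
      refine ⟨fun _ ↦ z u, fun w hw x hx hxu hxw ↦ ?_⟩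
      rw [sat_iff huv, hx.eq_walkGain_smul p hp, hxu, ← hz.eq_walkGain_smul p hp]
      exact hze _ _ huv
    · refine ⟨fun w ↦ ψ.gain e u v • w v, fun w hw x hx hxu hxw ↦ ?_⟩
      rw [sat_iff huv, hxu, hxw v hv]
  have hmod : ∀ w : α → P, ψ.IsSol X w → ∃ x : α → P, ψ.IsSol X x ∧ ψ.Sat x f ∧ ψ.Sat x e ∧
      x u = s w ∧ ∀ c, (¬ ∃ p : Walk G c u, p.edgeSet ⊆ X) → x c = w c := by
    intro w hw
    obtain ⟨x, hx, hxu, hxw⟩ := hw.exists_transport huv.left_mem (s := s w)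
      (fun c p p' hp hp' ↦ htr c p p' hp hp' _)
    have hxe := hs w hw x hx hxu hxw
    exact ⟨x, hx, hf x hx hxe, hxe, hxu, hxw⟩
  obtain ⟨y', hy', hyf', hye', hyu', hyw'⟩ := hmod y hy
  have hyy' : y u ≠ y' u := by
    intro h
    have hyall : ∀ c, y' c = y c := by
      intro c
      by_cases hc : ∃ p : Walk G c u, p.edgeSet ⊆ X
      · obtain ⟨p, hp⟩ := hc
        rw [hy.eq_walkGain_smul p hp, hy'.eq_walkGain_smul p hp, h]
      · exact hyw' c hc
    exact hye (by rwa [sat_iff huv₀, hyall, hyall, ← sat_iff huv₀] at hye')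
  -- it is impossible that just one end of `f` is in the component of `u`
  have hone : ∀ a b, G.IsLink f a b → (∃ p : Walk G a u, p.edgeSet ⊆ X) →
      ∃ p : Walk G b u, p.edgeSet ⊆ X := by
    rintro a b hab ⟨p, hp⟩
    by_contra hb
    have h1 := (sat_iff hab).1 hyf
    have h2 := (sat_iff hab).1 hyf'
    rw [hyw' b hb, ← h1, hy'.eq_walkGain_smul p hp, hy.eq_walkGain_smul p hp] at h2
    exact hyy' (MulAction.injective _ h2).symm
  -- If both ends of `f` are in the component of `u`, the equation of `f` becomes an equation for
  -- the value at `u`; it holds at the distinct points `y u` and `y' u`, hence everywhere. If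
  -- neither is, modifying `w` inside the component does not affect `f`.
  by_cases ha : ∃ p : Walk G a u, p.edgeSet ⊆ X
  · obtain ⟨q, hq⟩ := hone a b hab ha
    obtain ⟨p, hp⟩ := ha
    refine hwf ((sat_iff hab).2 ?_)
    rw [hw.eq_walkGain_smul p hp, hw.eq_walkGain_smul q hq, ← mul_smul]
    refine hP.smul_eq_smul hyy' ?_ ?_ _
    · rw [mul_smul, ← hy.eq_walkGain_smul p hp, ← hy.eq_walkGain_smul q hq]
      exact hyf _ _ hab
    · rw [mul_smul, ← hy'.eq_walkGain_smul p hp, ← hy'.eq_walkGain_smul q hq]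
      exact hyf' _ _ hab
  · have hb : ¬ ∃ p : Walk G b u, p.edgeSet ⊆ X := fun hb ↦ ha (hone b a hab.symm hb)
    obtain ⟨w', hw', hwf', -, -, hww'⟩ := hmod w hw
    rw [sat_iff hab, hww' a ha, hww' b hb, ← sat_iff hab] at hwf'
    exact hwf hwf'

/-! ### Frame pairs and the exchange property of the combined closure -/

/-- A pair of `Γ`-sets for a normal subgroup `N`: the elements of `N` fix every point of `T`, and
the others fix just the point `o`; in `S` the elements of `N \ {1}` fix no point, and those outside
`N` fix just one. -/
structure IsFramePair (N : Subgroup Γ) (S T : Type*) [MulAction Γ S] [MulAction Γ T] (o : T) :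
    Prop where
  smul_zero : ∀ g : Γ, g • o = o
  smul_of_mem : ∀ g ∈ N, ∀ t : T, g • t = t
  mem_of_smul : ∀ (g : Γ) (t : T), t ≠ o → g • t = t → g ∈ N
  exists_ne_zero : ∃ t : T, t ≠ o
  nontrivial : ∃ s t : S, s ≠ t
  eq_one_of_mem : ∀ g ∈ N, ∀ s : S, g • s = s → g = 1
  eq_of_smul : ∀ (g : Γ) (s t : S), s ≠ t → g • s = s → g • t = t → g = 1
  exists_fixed : ∀ g ∉ N, ∃ s : S, g • s = s

namespace IsFramePair

variable {N : Subgroup Γ} {S T : Type*} [MulAction Γ S] [MulAction Γ T] {o : T}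

lemma fixesAtMostOne_left (h : IsFramePair N S T o) : FixesAtMostOne Γ S := by
  intro g s t hst hs ht r
  rw [h.eq_of_smul g s t hst hs ht, one_smul]

lemma fixesAtMostOne_right (h : IsFramePair N S T o) : FixesAtMostOne Γ T := by
  intro g s t hst hs ht r
  rcases eq_or_ne s o with rfl | hs'
  · exact h.smul_of_mem g (h.mem_of_smul g t hst.symm ht) r
  · exact h.smul_of_mem g (h.mem_of_smul g s hs' hs) r

lemma exists_not_fixed (h : IsFramePair N S T o) {g : Γ} (hg : g ≠ 1) : ∃ s : S, g • s ≠ s := by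
  obtain ⟨s, t, hst⟩ := h.nontrivial
  by_contra! hc
  exact hg (h.eq_of_smul g s t hst (hc s) (hc t))

lemma isSol_zero (h : IsFramePair N S T o) (X : Set β) : ψ.IsSol X fun _ ↦ o :=
  fun _ _ _ _ _ ↦ (h.smul_zero _).symm

/-- If all solutions in `T` satisfy `f`, then two solutions in `S`, one of which satisfies `f`,
both do. -/
lemma sat_of_forall (h : IsFramePair N S T o) {X : Set β} {f : β}
    (hT : ∀ t : α → T, ψ.IsSol X t → ψ.Sat t f) {y w : α → S} (hy : ψ.IsSol X y)
    (hyf : ψ.Sat y f) (hw : ψ.IsSol X w) : ψ.Sat w f := by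
  by_contra hwf
  obtain ⟨a₀, b₀, hab₀⟩ := exists_isLink_of_not_sat hwf
  obtain ⟨a, b, hab, hyw⟩ : ∃ a b, G.IsLink f a b ∧ y a ≠ w a := by
    by_contra! hc
    refine hwf ((sat_iff hab₀).2 ?_)
    rw [← hc _ _ hab₀, ← hc _ _ hab₀.symm]
    exact hyf _ _ hab₀
  -- Two solutions in `S` that differ at `a` force parallel walks to `a` to have equal gains, since
  -- only the identity fixes two points.
  have hgain : ∀ (c : α) (p p' : Walk G c a), p.edgeSet ⊆ X → p'.edgeSet ⊆ X →
      (ψ.walkGain p')⁻¹ * ψ.walkGain p = 1 := by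
    intro c p p' hp hp'
    refine h.eq_of_smul _ _ _ hyw ?_ ?_
    · rw [mul_smul, ← hy.eq_walkGain_smul p hp, inv_smul_eq_iff, ← hy.eq_walkGain_smul p' hp']
    · rw [mul_smul, ← hw.eq_walkGain_smul p hp, inv_smul_eq_iff, ← hw.eq_walkGain_smul p' hp']
  obtain ⟨t₁, ht₁⟩ := h.exists_ne_zero
  -- A test solution in `T` supported on the component of `a`. As it satisfies `f`, the other end of
  -- `f` is in that component, and the closed walk through `f` has gain in `N`; this gain fixes `y
  -- a`, so it is the identity.
  obtain ⟨t, ht, hta, hto⟩ := (h.isSol_zero (ψ := ψ) X).exists_transport hab.left_mem (s := t₁)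
    (fun c p p' hp hp' ↦ by rw [inv_mul_eq_one.1 (hgain c p p' hp hp')])
  have htf := (sat_iff hab).1 (hT t ht)
  obtain ⟨p, hp⟩ : ∃ p : Walk G b a, p.edgeSet ⊆ X := by
    by_contra hb
    rw [hto b hb, h.smul_zero, hta] at htf
    exact ht₁ htf
  have hg : ψ.gain f a b * ψ.walkGain p ∈ N := by
    refine h.mem_of_smul _ t₁ ht₁ ?_
    rw [ht.eq_walkGain_smul p hp, hta, ← mul_smul] at htf
    exact htf.symm
  have hg1 : ψ.gain f a b * ψ.walkGain p = 1 := by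
    refine h.eq_one_of_mem _ hg (y a) ?_
    rw [mul_smul, ← hy.eq_walkGain_smul p hp]
    exact (hyf _ _ hab).symm
  refine hwf ((sat_iff hab).2 ?_)
  rw [hw.eq_walkGain_smul p hp, ← mul_smul, hg1, one_smul]

/-- If some solution in `T` violates `e`, then a solution in `S` can be changed both to one that
satisfies `e` and to one that violates `e`. -/
lemma exists_sat_and_exists_not_sat (h : IsFramePair N S T o) {X : Set β} {e : β} {w : α → S}
    (hw : ψ.IsSol X w) {t : α → T} (ht : ψ.IsSol X t) (hte : ¬ ψ.Sat t e) :
    (∃ x : α → S, ψ.IsSol X x ∧ ψ.Sat x e) ∧ ∃ x : α → S, ψ.IsSol X x ∧ ¬ ψ.Sat x e := by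
  obtain ⟨u₀, v₀, huv₀⟩ := exists_isLink_of_not_sat hte
  obtain ⟨u, v, huv, htu⟩ : ∃ u v, G.IsLink e u v ∧ t u ≠ o := by
    by_contra! hc
    refine hte ((sat_iff huv₀).2 ?_)
    rw [hc _ _ huv₀, hc _ _ huv₀.symm, h.smul_zero]
  -- Closed walks at `u` have gain in `N` because they fix the nonzero `t u`, and gain `1` because
  -- they also fix `w u`. So the value of `w` at `u` can be chosen freely.
  have hgain : ∀ (c : α) (p p' : Walk G c u), p.edgeSet ⊆ X → p'.edgeSet ⊆ X →
      (ψ.walkGain p')⁻¹ * ψ.walkGain p = 1 := by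
    intro c p p' hp hp'
    refine h.eq_one_of_mem _ (h.mem_of_smul _ _ htu ?_) (w u) ?_
    · rw [mul_smul, ← ht.eq_walkGain_smul p hp, inv_smul_eq_iff, ← ht.eq_walkGain_smul p' hp']
    · rw [mul_smul, ← hw.eq_walkGain_smul p hp, inv_smul_eq_iff, ← hw.eq_walkGain_smul p' hp']
  have htr : ∀ s : S, ∃ x : α → S, ψ.IsSol X x ∧ x u = s ∧
      ∀ a, (¬ ∃ p : Walk G a u, p.edgeSet ⊆ X) → x a = w a := fun s ↦
    hw.exists_transport huv.left_mem
      (fun c p p' hp hp' ↦ by rw [inv_mul_eq_one.1 (hgain c p p' hp hp')])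
  by_cases hv : ∃ p : Walk G v u, p.edgeSet ⊆ X
  · obtain ⟨p, hp⟩ := hv
    -- The edge `e` now says that this element fixes the value at `u`. Lying outside `N`, it has
    -- both a fixed and a moved point in `S`.
    have hg : ψ.gain e u v * ψ.walkGain p ∉ N := by
      intro hg
      refine hte ((sat_iff huv).2 ?_)
      rw [ht.eq_walkGain_smul p hp, ← mul_smul, h.smul_of_mem _ hg]
    have hxe : ∀ x : α → S, ψ.IsSol X x →
        (ψ.Sat x e ↔ (ψ.gain e u v * ψ.walkGain p) • x u = x u) := by
      intro x hx
      rw [sat_iff huv, hx.eq_walkGain_smul p hp, ← mul_smul, eq_comm]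
    obtain ⟨s, hs⟩ := h.exists_fixed _ hg
    obtain ⟨s', hs'⟩ := h.exists_not_fixed (g := ψ.gain e u v * ψ.walkGain p)
      (fun h1 ↦ hg (h1 ▸ N.one_mem))
    obtain ⟨x, hx, hxu, -⟩ := htr s
    obtain ⟨x', hx', hxu', -⟩ := htr s'
    exact ⟨⟨x, hx, (hxe x hx).2 (by rw [hxu, hs])⟩,
      ⟨x', hx', fun hc ↦ hs' (by rw [← hxu']; exact (hxe x' hx').1 hc)⟩⟩
  · obtain ⟨s, hs⟩ : ∃ s : S, s ≠ ψ.gain e u v • w v := by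
      obtain ⟨s, t, hst⟩ := h.nontrivial
      by_contra! hc
      exact hst ((hc s).trans (hc t).symm)
    obtain ⟨x, hx, hxu, hxw⟩ := htr (ψ.gain e u v • w v)
    obtain ⟨x', hx', hxu', hxw'⟩ := htr s
    refine ⟨⟨x, hx, (sat_iff huv).2 (by rw [hxu, hxw v hv])⟩, ⟨x', hx', fun hc ↦ hs ?_⟩⟩
    rw [sat_iff huv, hxu', hxw' v hv] at hc
    exact hc

end IsFramePair

/-- The closure operator on the edges and an additional element `none`, given by the labellings
in `S`, which violate `none`, and those in `T`, which satisfy it. -/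
def liftClosure (ψ : GainFunction G Γ) (S T : Type*) [MulAction Γ S] [MulAction Γ T] :
    ClosureOperator (Set (Option β)) :=
  ClosureOperator.mk'
    (fun Y ↦ {o | (none ∉ Y → ∀ x : α → S, ψ.IsSol (some ⁻¹' Y) x → ∃ e, o = some e ∧ ψ.Sat x e) ∧
      ∀ t : α → T, ψ.IsSol (some ⁻¹' Y) t → ∀ e, o = some e → ψ.Sat t e})
    (fun Y Z hYZ o ho ↦ ⟨fun hn x hx ↦ ho.1 (fun h ↦ hn (hYZ h)) x
        (isSol_mono hx (Set.preimage_mono hYZ)),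
      fun t ht ↦ ho.2 t (isSol_mono ht (Set.preimage_mono hYZ))⟩)
    (fun Y o ho ↦ ⟨fun hn x hx ↦ by
        obtain _ | e := o
        · exact absurd ho hn
        · exact ⟨e, rfl, hx e ho⟩,
      fun t ht e he ↦ by subst he; exact ht e ho⟩)
    (fun Y o ho ↦ by
      refine ⟨fun hn x hx ↦ ho.1 (fun hc ↦ ?_) x ?_, fun t ht e he ↦ ho.2 t ?_ e he⟩
      · obtain ⟨e, he, -⟩ := hc.1 hn x hx
        cases he
      · intro e he
        obtain ⟨e', he', h⟩ := he.1 hn x hx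
        cases he'
        exact h
      · exact fun e he ↦ he.2 t ht e rfl)

variable {S T : Type*} [MulAction Γ S] [MulAction Γ T]

lemma none_mem_liftClosure {Y : Set (Option β)} :
    none ∈ ψ.liftClosure S T Y ↔ none ∈ Y ∨ ∀ x : α → S, ¬ ψ.IsSol (some ⁻¹' Y) x := by
  change (_ ∧ _) ↔ _
  by_cases h : none ∈ Y <;> simp [h]

lemma some_mem_liftClosure {Y : Set (Option β)} {e : β} :
    some e ∈ ψ.liftClosure S T Y ↔
      (none ∉ Y → ∀ x : α → S, ψ.IsSol (some ⁻¹' Y) x → ψ.Sat x e) ∧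
        ∀ t : α → T, ψ.IsSol (some ⁻¹' Y) t → ψ.Sat t e := by
  change (_ ∧ _) ↔ _
  simp

lemma preimage_insert_none {Y : Set (Option β)} : some ⁻¹' insert none Y = some ⁻¹' Y := by
  ext; simp

lemma preimage_insert_some {Y : Set (Option β)} {e : β} :
    some ⁻¹' insert (some e) Y = insert e (some ⁻¹' Y) := by
  ext; simp

/-- Exchange within one `Γ`-set is `sat_of_exchange`. The mixed cases use that a violation in `T`
leaves a choice in `S` (`exists_sat_and_exists_not_sat`), and that an edge forced in `T` holds for
all solutions in `S` or for none (`sat_of_forall`). -/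
lemma IsFramePair.hasExchange {N : Subgroup Γ} {o : T} (h : IsFramePair N S T o) :
    Matroid.HasExchange (ψ.liftClosure S T) := by
  intro Y e f hfe hf
  have hfY : f ∉ Y := fun hfY ↦ hf ((ψ.liftClosure S T).le_closure Y hfY)
  have exch : ∀ {e f : β}, (∀ t : α → T, ψ.IsSol (some ⁻¹' Y) t → ψ.Sat t e → ψ.Sat t f) →
      (¬ ∀ t : α → T, ψ.IsSol (some ⁻¹' Y) t → ψ.Sat t f) →
      ∀ t : α → T, ψ.IsSol (some ⁻¹' Y) t → ψ.Sat t f → ψ.Sat t e := by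
    intro e f hef hnf t ht htf
    by_contra hte
    exact hnf fun t' ht' ↦ sat_of_exchange h.fixesAtMostOne_right ht htf hte
      (h.isSol_zero _) (fun _ _ _ ↦ (h.smul_zero _).symm) hef ht'
  by_cases hY : none ∈ Y
  · obtain _ | f := f
    · exact absurd hY hfY
    obtain _ | e := e
    · exact (ψ.liftClosure S T).le_closure _ (Set.mem_insert_of_mem _ hY)
    simp only [some_mem_liftClosure, preimage_insert_some, isSol_insert, Set.mem_insert_iff, hY,
      or_true, not_true_eq_false, false_implies, true_and] at hf hfe ⊢
    exact fun t ht ↦ exch (fun t ht hte ↦ hfe t ⟨hte, ht⟩) hf t ht.2 ht.1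
  obtain _ | f := f
  · obtain _ | e := e
    · exact hfe
    simp only [none_mem_liftClosure, preimage_insert_some, isSol_insert, Set.mem_insert_iff, hY,
      or_false, false_or, reduceCtorEq, not_forall, not_not] at hf hfe
    obtain ⟨w, hw⟩ := hf
    simp only [some_mem_liftClosure, preimage_insert_none, Set.mem_insert_iff, true_or,
      not_true_eq_false, false_implies, true_and]
    intro t ht
    by_contra hte
    obtain ⟨x, hx, hxe⟩ := (h.exists_sat_and_exists_not_sat hw ht hte).1
    exact hfe x ⟨hxe, hx⟩
  obtain _ | e := e
  · simp only [some_mem_liftClosure, preimage_insert_none, Set.mem_insert_iff, true_or, hY,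
      not_true_eq_false, false_implies, true_and, not_false_eq_true, true_implies] at hf hfe
    simp only [none_mem_liftClosure, preimage_insert_some, isSol_insert, Set.mem_insert_iff, hY,
      or_false, reduceCtorEq, false_or]
    rintro y ⟨hyf, hy⟩
    exact hf ⟨fun w hw ↦ h.sat_of_forall hfe hy hyf hw, hfe⟩
  simp only [some_mem_liftClosure, preimage_insert_some, isSol_insert, Set.mem_insert_iff, hY,
    or_false, reduceCtorEq, not_false_eq_true, true_implies] at hf hfe ⊢
  obtain ⟨hfeS, hfeT⟩ := hfe
  -- If `f` is forced in `T`, it fails for every solution in `S`, of which there is at least one. A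
  -- violation of `e` in `T` would allow a solution in `S` satisfying `e`, and hence `f`.
  by_cases hT : ∀ t : α → T, ψ.IsSol (some ⁻¹' Y) t → ψ.Sat t f
  · have hS : ∀ y : α → S, ψ.IsSol (some ⁻¹' Y) y → ¬ ψ.Sat y f := fun y hy hyf ↦
      hf ⟨fun w hw ↦ h.sat_of_forall hT hy hyf hw, hT⟩
    refine ⟨fun y hy ↦ absurd hy.1 (hS y hy.2), fun t ht ↦ ?_⟩
    by_contra hte
    obtain ⟨w, hw⟩ : ∃ w : α → S, ψ.IsSol (some ⁻¹' Y) w := by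
      by_contra! hc
      exact hf ⟨fun w hw ↦ absurd hw (hc w), hT⟩
    obtain ⟨x, hx, hxe⟩ := (h.exists_sat_and_exists_not_sat hw ht.2 hte).1
    exact hS x hx (hfeS x ⟨hxe, hx⟩)
  · refine ⟨fun y hy ↦ ?_, fun t ht ↦ exch (fun t ht hte ↦ hfeT t ⟨hte, ht⟩) hT t ht.2 ht.1⟩
    by_contra hye
    push Not at hT
    obtain ⟨t, ht, htf⟩ := hT
    have hte : ¬ ψ.Sat t e := fun hte ↦ htf (hfeT t ⟨hte, ht⟩)
    obtain ⟨z, hz, hze⟩ := (h.exists_sat_and_exists_not_sat hy.2 ht hte).1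
    obtain ⟨x, hx, hxf⟩ := (h.exists_sat_and_exists_not_sat hy.2 ht htf).2
    exact hxf (sat_of_exchange h.fixesAtMostOne_left hy.2 hy.1 hye hz hze
      (fun x hx hxe ↦ hfeS x ⟨hxe, hx⟩) hx)

/-- The matroid on the edges and `none` whose closure on finite sets is `liftClosure`. -/
lemma IsFramePair.exists_matroid {N : Subgroup Γ} {o : T} (h : IsFramePair N S T o)
    (ψ : GainFunction G Γ) :
    ∃ K : Matroid (Option β), K.Finitary ∧ K.IsNonloop none ∧ K.contractNone.E = G.edgeSet ∧
      (∀ X ⊆ G.edgeSet, X.Finite → ∀ e ∈ G.edgeSet,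
        (e ∈ K.contractNone.closure X ↔ ∀ t : α → T, ψ.IsSol X t → ψ.Sat t e)) ∧
      ∀ X ⊆ G.edgeSet, X.Finite →
        (none ∈ K.closure (some '' X) ↔ ∀ x : α → S, ¬ ψ.IsSol X x) := by
  obtain ⟨K, hE, hK, hcl⟩ := Matroid.exists_finitary_of_closure (h.hasExchange (ψ := ψ))
    (insert none (some '' G.edgeSet)) (by
      rintro (_ | e) he
      · simp at he
      · have he' : ∀ u v, ¬ G.IsLink e u v := fun u v huv ↦ he (by simp [huv.edge_mem])
        rw [some_mem_liftClosure]
        exact ⟨fun _ x _ u v huv ↦ absurd huv (he' u v), fun x _ u v huv ↦ absurd huv (he' u v)⟩)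
  have hpre : ∀ X : Set β, some ⁻¹' (some '' X) = X :=
    fun X ↦ Set.preimage_image_eq X (Option.some_injective β)
  have hnone : ∀ X ⊆ G.edgeSet, X.Finite →
        (none ∈ K.closure (some '' X) ↔ ∀ x : α → S, ¬ ψ.IsSol X x) := by
    intro X hX hXf
    rw [hcl _ ((Set.image_mono hX).trans (Set.subset_insert _ _)) (hXf.image _)]
    simp [none_mem_liftClosure, hpre]
  refine ⟨K, hK, ?_, ?_, fun X hX hXf e he ↦ ?_, hnone⟩
  · have h0 := hnone ∅ (Set.empty_subset _) Set.finite_empty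
    rw [Set.image_empty] at h0
    refine Matroid.isNonloop_of_notMem_closure (X := ∅) (fun hc ↦ ?_) (by simp [hE])
    obtain ⟨s, -⟩ := h.nontrivial
    exact h0.1 hc (fun _ ↦ s) (fun e he ↦ absurd he (Set.notMem_empty e))
  · rw [Matroid.contractNone_ground, hE]
    ext; simp
  · rw [Matroid.mem_contractNone_closure_iff,
      hcl _ (Set.insert_subset_insert (Set.image_mono hX)) ((hXf.image _).insert _)]
    simp [some_mem_liftClosure, preimage_insert_none, hpre, he]

end GainFunction

/-! ### Building theta graphs, ears and lollipops -/

/-- The vertex `x` is an end of an edge in `X`. -/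
def Touches (G : Graph α β) (X : Set β) (x : α) : Prop := ∃ e ∈ X, ∃ y, G.IsLink e x y

lemma not_touches_empty {x : α} : ¬ Touches G ∅ x := by simp [Touches]

lemma touches_union {X Y : Set β} {x : α} :
    Touches G (X ∪ Y) x ↔ Touches G X x ∨ Touches G Y x := by
  simp [Touches, or_and_right, exists_or]

lemma Walk.mem_support_of_touches {x y z : α} {p : Walk G x y} (h : Touches G p.edgeSet z) :
    z ∈ p.support := by
  obtain ⟨e, he, w, hl⟩ := h
  exact left_mem_support he hl

namespace Walk

lemma IsSimpleClosed.of_append {x z : α} {a : Walk G x z} {b : Walk G z x}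
    (h : (a.append b).IsSimpleClosed) (hz : z ≠ x) : a.IsPath ∧ b.IsPath ∧
      a.edges.Disjoint b.edges ∧ ∀ w, w ∈ a.support → w ∈ b.support → w = x ∨ w = z := by
  have hne := h.1
  rw [edges_append] at hne
  obtain ⟨h1, h2⟩ := (isSimpleClosed_append hne).1 h
  rw [List.nodup_append] at h1 h2
  have hx : x ∈ b.support.tail := by
    have := b.end_mem
    rw [support_eq_cons, List.mem_cons] at this
    exact this.resolve_left hz.symm
  have hz' : z ∈ a.support.tail := by
    have := a.end_mem
    rw [support_eq_cons, List.mem_cons] at this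
    exact this.resolve_left hz
  refine ⟨?_, ?_, fun e he he' ↦ h1.2.2 e he e he' rfl, fun w hw hw' ↦ ?_⟩
  · rw [IsPath, support_eq_cons, List.nodup_cons]
    exact ⟨fun hxa ↦ h2.2.2 x hxa x hx rfl, h2.1⟩
  · rw [IsPath, support_eq_cons, List.nodup_cons]
    exact ⟨fun hzb ↦ h2.2.2 z hz' z hzb rfl, h2.2.1⟩
  · rw [support_eq_cons, List.mem_cons] at hw hw'
    rcases hw with rfl | hw
    · exact .inl rfl
    rcases hw' with rfl | hw'
    · exact .inr rfl
    exact absurd rfl (h2.2.2 w hw w hw')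

lemma isTheta_of_isPath {x z : α} {p : Walk G x x} (hp : p.IsSimpleClosed) (hz : z ∈ p.support)
    (hzx : z ≠ x) {r : Walk G x z} (hr : r.IsPath) (hd : r.edges.Disjoint p.edges)
    (hs : ∀ w ∈ r.support, w ∈ p.support → w = x ∨ w = z) : IsTheta G (p.edgeSet ∪ r.edgeSet) := by
  obtain ⟨a, b, rfl⟩ := p.exists_eq_append_of_mem_support hz
  obtain ⟨ha, hb, hab, hsab⟩ := hp.of_append hzx
  have hra : r.edges.Disjoint a.edges := fun e he he' ↦ hd he (by simp [he'])
  have hrb : r.edges.Disjoint b.edges := fun e he he' ↦ hd he (by simp [he'])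
  have hsa : ∀ w ∈ r.support, w ∈ a.support → w = x ∨ w = z :=
    fun w hw hw' ↦ hs w hw (mem_support_append.2 (.inl hw'))
  have hsb : ∀ w ∈ r.support, w ∈ b.support → w = x ∨ w = z :=
    fun w hw hw' ↦ hs w hw (mem_support_append.2 (.inr hw'))
  refine ⟨x, z, ![a, b.reverse, r], hzx.symm, ?_, ?_, ?_⟩
  · intro i
    fin_cases i
    · exact ha
    · exact hb.reverse
    · exact hr
  · intro i j hij
    fin_cases i <;> fin_cases j <;> simp at hij ⊢
    · exact ⟨fun e he he' ↦ hab he (by simpa using he'), hsab⟩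
    · exact ⟨hra.symm, fun w hw hw' ↦ hsa w hw' hw⟩
    · exact ⟨fun e he he' ↦ hab he' (by simpa using he), fun w hw hw' ↦ hsab w hw' hw⟩
    · exact ⟨fun e he he' ↦ hrb he' (by simpa using he), fun w hw hw' ↦ hsb w hw' hw⟩
    · exact ⟨hra, hsa⟩
    · exact ⟨fun e he he' ↦ hrb he (by simpa using he'), hsb⟩
  · ext e
    simp [Fin.exists_fin_succ, edgeSet, or_assoc]

/-- Extending a path as far as possible, in a set of edges without ends of degree one outside `W`,
leads either back to `W` or to a cycle attached to the path. -/
lemma exists_ear_or_lollipop {X : Set β} (hX : X.Finite) {W : Set α}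
    (hmin : ∀ e ∈ X, ∀ y z, G.IsLink e y z → y ∉ W → y ≠ z → ∃ f ∈ X, f ≠ e ∧ ∃ z', G.IsLink f y z')
    {x : α} : ∀ (n : ℕ) {y y' : α} (e : β) (h : G.IsLink e y y') (r : Walk G y' x),
      X.ncard - (cons e h r).edges.length = n → (cons e h r).IsPath → (cons e h r).edgeSet ⊆ X →
      (∀ w ∈ (cons e h r).support, w ∈ W → w = x) →
      (∃ z ∈ W, z ≠ x ∧ ∃ r : Walk G z x, r.IsPath ∧ r.edgeSet ⊆ X ∧
        ∀ w ∈ r.support, w ∈ W → w = z ∨ w = x) ∨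
      ∃ (z : α) (b : Walk G z x) (q : Walk G z z), q.IsSimpleClosed ∧ b.IsPath ∧ q.edgeSet ⊆ X ∧
        b.edgeSet ⊆ X ∧ (∀ w ∈ b.support, w ∈ W → w = x) ∧ (∀ w ∈ q.support, w ∈ W → w = x) ∧
        ∀ w ∈ b.support, w ∈ q.support → w = z := by
  intro n
  induction n using Nat.strong_induction_on with
  | _ n ih =>
  intro y y' e h r hn hr hrX hW
  obtain ⟨hyr, hr'⟩ := isPath_cons.1 hr
  have hyx : y ≠ x := fun hyx ↦ hyr (hyx ▸ r.end_mem)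
  have hyy' : y ≠ y' := fun hy ↦ hyr (hy ▸ r.start_mem)
  have hyW : y ∉ W := fun hy ↦ hyx (hW y (start_mem _) hy)
  -- The first vertex of the path is outside `W`, so a further edge `f` leaves it. Its other end
  -- closes a cycle, reaches `W`, or lengthens the path.
  obtain ⟨f, hfX, hfe, z, hf⟩ := hmin e (hrX (by simp [edgeSet, edges])) y y' h hyW hyy'
  have hfr : f ∉ (cons e h r).edges := by
    simp only [edges, List.mem_cons, not_or]
    exact ⟨hfe, fun hfr ↦ hyr (left_mem_support hfr hf)⟩
  by_cases hz : z ∈ (cons e h r).support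
  · obtain ⟨a, b, hab⟩ := exists_eq_append_of_mem_support _ hz
    rw [hab] at hr hfr hrX hW
    rw [edgeSet_append, Set.union_subset_iff] at hrX
    obtain ⟨ha, hb, hs⟩ := isPath_append.1 hr
    refine .inr ⟨z, b, cons f hf.symm a, isSimpleClosed_cons.2 ⟨fun hc ↦ hfr (by simp [hc]), ha⟩,
      hb, ?_, hrX.2, fun w hw ↦ hW w (mem_support_append.2 (.inr hw)), ?_, ?_⟩
    · rw [edgeSet_cons]
      exact Set.insert_subset hfX hrX.1
    · intro w hw
      simp only [support, List.mem_cons] at hw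
      rcases hw with rfl | hw
      · exact hW w (mem_support_append.2 (.inr b.start_mem))
      · exact hW w (mem_support_append.2 (.inl hw))
    · intro w hw hw'
      simp only [support, List.mem_cons] at hw'
      rcases hw' with rfl | hw'
      · rfl
      · exact hs w hw' hw
  have hpath : (cons f hf.symm (cons e h r)).IsPath := isPath_cons.2 ⟨hz, hr⟩
  have hsub : (cons f hf.symm (cons e h r)).edgeSet ⊆ X := by
    rw [edgeSet_cons]
    exact Set.insert_subset hfX hrX
  by_cases hzW : z ∈ W
  · refine .inl ⟨z, hzW, by rintro rfl; exact hz (end_mem _), _, hpath, hsub, fun w hw hwW ↦ ?_⟩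
    rw [support, List.mem_cons] at hw
    exact hw.imp_right fun hw ↦ hW w hw hwW
  · refine ih _ ?_ f hf.symm (cons e h r) rfl hpath hsub fun w hw hwW ↦ ?_
    · have hlen : (cons f hf.symm (cons e h r)).edges.length ≤ X.ncard := by
        classical
        rw [← List.toFinset_card_of_nodup hpath.nodup_edges, ← Set.ncard_coe_finset]
        refine Set.ncard_le_ncard (fun g hg ↦ hsub ?_) hX
        simpa [edgeSet] using hg
      have : (cons f hf.symm (cons e h r)).edges.length = (cons e h r).edges.length + 1 := rfl
      omega
    · rw [support, List.mem_cons] at hw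
      rcases hw with rfl | hw
      · exact absurd hwW hzW
      · exact hW w hw hwW

end Walk

/-! ### Independent sets of the matroid defined by labellings in `T` -/

namespace GainFunction

variable {P : Type*} [MulAction Γ P] {ψ : GainFunction G Γ}

/-- On a path, a solution is determined by an arbitrary value at the last vertex. -/
lemma exists_isSol_path (ψ : GainFunction G Γ) (w : α → P) (s : P) :
    ∀ {y z : α} (q : Walk G y z), q.IsPath →
      ∃ x : α → P, ψ.IsSol q.edgeSet x ∧ x z = s ∧ ∀ a ∉ q.support, x a = w a
  | _, _, .nil z _, _ => by
    classical
    refine ⟨Function.update w z s, fun e he ↦ by simp [Walk.edgeSet, Walk.edges] at he, by simp,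
      fun a ha ↦ ?_⟩
    rw [Function.update_of_ne]
    simpa [Walk.support] using ha
  | u, z, .cons (y := v) e h q, hq => by
    classical
    obtain ⟨hu, hq⟩ := Walk.isPath_cons.1 hq
    obtain ⟨x, hx, hxz, hxw⟩ := exists_isSol_path ψ w s q hq
    refine ⟨Function.update x u (ψ.gain e u v • x v), fun f hf ↦ ?_, ?_, fun a ha ↦ ?_⟩
    · rw [Walk.edgeSet_cons] at hf
      rcases hf with rfl | hf
      · rw [sat_iff h, Function.update_self, Function.update_of_ne]
        exact fun hv ↦ hu (hv ▸ q.start_mem)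
      · intro a b hab
        rw [Function.update_of_ne, Function.update_of_ne]
        · exact hx f hf a b hab
        · exact fun hb ↦ hu (hb ▸ Walk.right_mem_support hf hab)
        · exact fun ha ↦ hu (ha ▸ Walk.left_mem_support hf hab)
    · rw [Function.update_of_ne, hxz]
      exact fun hz ↦ hu (hz ▸ q.end_mem)
    · simp only [Walk.support, List.mem_cons, not_or] at ha
      rw [Function.update_of_ne ha.1, hxw a ha.2]

/-- `F` is a finitary matroid on the edges of `G` whose closure is given by the labellings in the
`Γ`-set `T`. -/
structure IsSolMatroid (ψ : GainFunction G Γ) (T : Type*) [MulAction Γ T] (F : Matroid β) :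
    Prop where
  finitary : F.Finitary
  ground_eq : F.E = G.edgeSet
  mem_closure_iff : ∀ X ⊆ G.edgeSet, X.Finite → ∀ e ∈ G.edgeSet,
    (e ∈ F.closure X ↔ ∀ t : α → T, ψ.IsSol X t → ψ.Sat t e)

variable {N : Subgroup Γ} {S T : Type*} [MulAction Γ S] [MulAction Γ T] {o : T} {F : Matroid β}

lemma IsFramePair.eq_zero_of_walkGain_notMem (h : IsFramePair N S T o) {X : Set β} {t : α → T}
    (ht : ψ.IsSol X t) {x : α} {p : Walk G x x} (hp : p.edgeSet ⊆ X) (hg : ψ.walkGain p ∉ N) :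
    t x = o := by
  by_contra hx
  exact hg (h.mem_of_smul _ _ hx (ht.eq_walkGain_smul p hp).symm)

lemma IsFramePair.eq_zero_of_walk (h : IsFramePair N S T o) {X : Set β} {t : α → T}
    (ht : ψ.IsSol X t) {x y : α} {p : Walk G x y} (hp : p.edgeSet ⊆ X) (hy : t y = o) :
    t x = o := by
  rw [ht.eq_walkGain_smul p hp, hy, h.smul_zero]

lemma IsFramePair.eq_zero_of_walk' (h : IsFramePair N S T o) {X : Set β} {t : α → T}
    (ht : ψ.IsSol X t) {x y : α} {p : Walk G x y} (hp : p.edgeSet ⊆ X) (hx : t x = o) :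
    t y = o :=
  h.eq_zero_of_walk ht (p := p.reverse) (by rwa [Walk.edgeSet_reverse]) hx

namespace IsSolMatroid

lemma indep_insert (hF : IsSolMatroid ψ T F) {I : Set β} (hI : F.Indep I) (hIf : I.Finite) {e : β}
    {t : α → T} (ht : ψ.IsSol I t) (hte : ¬ ψ.Sat t e) : F.Indep (insert e I) := by
  obtain ⟨u, v, huv⟩ := exists_isLink_of_not_sat hte
  have hIE : I ⊆ G.edgeSet := hF.ground_eq ▸ hI.subset_ground
  refine hI.insert_indep_iff.2 (.inl ⟨hF.ground_eq ▸ huv.edge_mem, fun hc ↦ ?_⟩)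
  exact hte ((hF.mem_closure_iff I hIE hIf e huv.edge_mem).1 hc t ht)

lemma exists_isSol_of_indep (hF : IsSolMatroid ψ T F) {I : Set β} (hI : F.Indep I) (hIf : I.Finite)
    {e : β} (he : e ∈ I) : ∃ t : α → T, ψ.IsSol (I \ {e}) t ∧ ¬ ψ.Sat t e := by
  have hIE : I ⊆ G.edgeSet := hF.ground_eq ▸ hI.subset_ground
  have := hI.notMem_closure_sdiff_of_mem he
  rw [hF.mem_closure_iff _ (Set.sdiff_subset.trans hIE) hIf.sdiff e (hIE he)] at this
  push Not at this
  exact this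

lemma sat_of_isCircuit (hF : IsSolMatroid ψ T F) {C : Set β} (hC : F.IsCircuit C)
    {e : β} (he : e ∈ C) {t : α → T} (ht : ψ.IsSol (C \ {e}) t) : ψ.Sat t e := by
  have := hF.finitary
  have hCE : C ⊆ G.edgeSet := hF.ground_eq ▸ hC.subset_ground
  exact (hF.mem_closure_iff _ (Set.sdiff_subset.trans hCE) hC.finite.sdiff e (hCE he)).1
    (hC.mem_closure_sdiff_singleton_of_mem he) t ht

lemma dep_of_forall_sat (hF : IsSolMatroid ψ T F) {C : Set β} (hC : C ⊆ G.edgeSet) (hCf : C.Finite)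
    {e : β} (he : e ∈ C) (h : ∀ t : α → T, ψ.IsSol (C \ {e}) t → ψ.Sat t e) : F.Dep C := by
  refine ⟨fun hi ↦ ?_, hF.ground_eq ▸ hC⟩
  obtain ⟨t, ht, hte⟩ := hF.exists_isSol_of_indep hi hCf he
  exact hte (h t ht)

variable (hF : IsSolMatroid ψ T F) (h : IsFramePair N S T o)
include hF h

/-- The labelling that is nonzero only at the new vertex `u` satisfies `I` and violates `e`. -/
lemma indep_insert_of_not_touches {I : Set β} (hI : F.Indep I)
    (hIf : I.Finite) {e : β} {u v : α} (huv : G.IsLink e u v) (hne : u ≠ v)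
    (hu : ¬ Touches G I u) : F.Indep (insert e I) := by
  classical
  obtain ⟨s, hs⟩ := h.exists_ne_zero
  refine hF.indep_insert hI hIf (t := Function.update (fun _ ↦ o) u s) (fun f hf a b hab ↦ ?_) ?_
  · rw [Function.update_of_ne, Function.update_of_ne, h.smul_zero]
    · rintro rfl
      exact hu ⟨f, hf, _, hab.symm⟩
    · rintro rfl
      exact hu ⟨f, hf, _, hab⟩
  · rw [sat_iff huv, Function.update_self, Function.update_of_ne hne.symm, h.smul_zero]
    exact hs

lemma indep_union_path {I : Set β} (hI : F.Indep I)
    (hIf : I.Finite) : ∀ {y z : α} (q : Walk G y z), q.IsPath →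
      (∀ w ∈ q.support, Touches G I w → w = z) → F.Indep (I ∪ q.edgeSet)
  | _, _, .nil z _, _, _ => by simpa [Walk.edgeSet, Walk.edges]
  | u, z, .cons (y := v) e hl q, hq, hs => by
    obtain ⟨hu, hq⟩ := Walk.isPath_cons.1 hq
    have ih := indep_union_path hI hIf q hq (fun w hw ↦ hs w (by simp [Walk.support, hw]))
    rw [Walk.edgeSet_cons, Set.union_insert]
    refine hF.indep_insert_of_not_touches h ih (hIf.union q.finite_edgeSet) hl
      (fun hv ↦ hu (hv ▸ q.start_mem)) fun ht ↦ ?_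
    rcases touches_union.1 ht with ht | ht
    · exact hu (hs u (Walk.start_mem _) ht ▸ q.end_mem)
    · exact hu (Walk.mem_support_of_touches ht)

/-- Spread a nonzero label along the cycle minus one edge, with zero elsewhere. The last edge would
force the cycle gain to fix a nonzero point, and so to lie in `N`. -/
lemma indep_union_cycle {I : Set β} (hI : F.Indep I)
    (hIf : I.Finite) {x : α} {p : Walk G x x} (hp : p.IsSimpleClosed) (hg : ψ.walkGain p ∉ N)
    (hs : ∀ w ∈ p.support, ¬ Touches G I w) : F.Indep (I ∪ p.edgeSet) := by
  obtain ⟨y, e, hl, q, rfl, -, hq⟩ := hp.exists_eq_cons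
  have hsq : ∀ w ∈ q.support, ¬ Touches G I w := fun w hw ↦ hs w (by simp [Walk.support, hw])
  have ih := hF.indep_union_path h hI hIf q hq (fun w hw ht ↦ absurd ht (hsq w hw))
  obtain ⟨s, hs'⟩ := h.exists_ne_zero
  obtain ⟨t, ht, htx, hto⟩ := exists_isSol_path ψ (fun _ ↦ o) s q hq
  rw [Walk.edgeSet_cons, Set.union_insert]
  refine hF.indep_insert ih (hIf.union q.finite_edgeSet)
    (isSol_union.2 ⟨fun f hf a b hab ↦ ?_, ht⟩) fun hte ↦ hg ?_
  · rw [hto a fun ha ↦ hsq a ha ⟨f, hf, b, hab⟩, hto b fun hb ↦ hsq b hb ⟨f, hf, a, hab.symm⟩,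
      h.smul_zero]
  · refine h.mem_of_smul _ s hs' ?_
    rw [walkGain, mul_smul]
    rw [sat_iff hl, ht.eq_walkGain_smul q subset_rfl, htx] at hte
    exact hte.symm

lemma indep_cycle {x : α} {p : Walk G x x} (hp : p.IsSimpleClosed) (hg : ψ.walkGain p ∉ N) :
    F.Indep p.edgeSet := by
  simpa using hF.indep_union_cycle h F.empty_indep Set.finite_empty hp hg
    (fun w _ ↦ not_touches_empty)

/-- A cycle with one edge removed, attached at one vertex. -/
lemma indep_union_cycle_sdiff {I : Set β} (hI : F.Indep I) (hIf : I.Finite) {x : α}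
    {p : Walk G x x} (hp : p.IsSimpleClosed) (hs : ∀ w ∈ p.support, Touches G I w → w = x) {f : β}
    (hf : f ∈ p.edges) : F.Indep (I ∪ p.edgeSet \ {f}) := by
  obtain ⟨c, d, hl, a, b, rfl⟩ := p.exists_eq_append_of_mem_edges hf
  obtain ⟨-, h2⟩ := (Walk.isSimpleClosed_append (by simp [Walk.edges])).1 hp
  simp only [Walk.support, List.tail_cons, List.nodup_append] at h2
  have hxa : x ∉ a.support.tail := fun hx ↦ h2.2.2 x hx x b.end_mem rfl
  have ha : a.IsPath := by
    rw [Walk.IsPath, Walk.support_eq_cons, List.nodup_cons]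
    exact ⟨hxa, h2.1⟩
  have i1 := hF.indep_union_path h hI hIf a.reverse ha.reverse fun w hw ↦ hs w
    (Walk.mem_support_append.2 (.inl (by simpa using hw)))
  have i2 := hF.indep_union_path h i1 (hIf.union a.reverse.finite_edgeSet) b h2.2.1 fun w hw ht ↦ by
    rcases touches_union.1 ht with ht | ht
    · exact hs w (Walk.mem_support_append.2 (.inr (by simp [Walk.support, hw]))) ht
    · rw [Walk.edgeSet_reverse] at ht
      have hwa := Walk.mem_support_of_touches ht
      rw [Walk.support_eq_cons, List.mem_cons] at hwa
      exact hwa.resolve_right fun hwa ↦ h2.2.2 w hwa w hw rfl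
  refine i2.subset ?_
  rintro e (he | ⟨he, hef⟩)
  · exact .inl (.inl he)
  · rw [Walk.edgeSet_append, Walk.edgeSet_cons] at he
    rw [Walk.edgeSet_reverse]
    rcases he with he | he | he
    · exact .inl (.inr he)
    · exact absurd he hef
    · exact .inr he

/-- A path with one edge removed, attached at both ends. -/
lemma indep_union_path_sdiff {I : Set β} (hI : F.Indep I) (hIf : I.Finite) {x y : α}
    {p : Walk G x y} (hp : p.IsPath) (hs : ∀ w ∈ p.support, Touches G I w → w = x ∨ w = y) {f : β}
    (hf : f ∈ p.edges) : F.Indep (I ∪ p.edgeSet \ {f}) := by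
  obtain ⟨c, d, hl, a, b, rfl⟩ := p.exists_eq_append_of_mem_edges hf
  obtain ⟨ha, hb, hab⟩ := Walk.isPath_append.1 hp
  obtain ⟨hcb, hb⟩ := Walk.isPath_cons.1 hb
  have hab' : ∀ w ∈ a.support, w ∉ b.support := fun w hw hw' ↦
    hcb (hab w hw (by simp [Walk.support, hw']) ▸ hw')
  have i1 := hF.indep_union_path h hI hIf a.reverse ha.reverse fun w hw ht ↦ by
    have hw' : w ∈ a.support := by simpa using hw
    refine (hs w (Walk.mem_support_append.2 (.inl hw')) ht).resolve_right ?_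
    rintro rfl
    exact hab' w hw' b.end_mem
  have i2 := hF.indep_union_path h i1 (hIf.union a.reverse.finite_edgeSet) b hb fun w hw ht ↦ by
    rcases touches_union.1 ht with ht | ht
    · refine (hs w (Walk.mem_support_append.2 (.inr (by simp [Walk.support, hw]))) ht).resolve_left
        ?_
      rintro rfl
      exact hab' w a.start_mem hw
    · rw [Walk.edgeSet_reverse] at ht
      exact absurd hw (hab' w (Walk.mem_support_of_touches ht))
  refine i2.subset ?_
  rintro e (he | ⟨he, hef⟩)
  · exact .inl (.inl he)
  · rw [Walk.edgeSet_append, Walk.edgeSet_cons] at he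
    rw [Walk.edgeSet_reverse]
    rcases he with he | he | he
    · exact .inl (.inr he)
    · exact absurd he hef
    · exact .inr he

end IsSolMatroid

end GainFunction

/-! ### Frame circuits are circuits of the matroid -/

lemma IsTightHandcuff.exists_isCycle {C : Set β} (h : IsTightHandcuff G C) :
    ∃ (x : α) (p : Walk G x x), p.IsSimpleClosed ∧ p.edgeSet ⊂ C := by
  obtain ⟨x, p, q, hp, hq, hpq, -, rfl⟩ := h
  refine ⟨x, p, hp, Set.subset_union_left, fun hs ↦ ?_⟩
  obtain ⟨e, he⟩ := List.exists_mem_of_ne_nil _ hq.1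
  exact hpq (hs (.inr he)) he

lemma IsLooseHandcuff.exists_isCycle {C : Set β} (h : IsLooseHandcuff G C) :
    ∃ (x : α) (p : Walk G x x), p.IsSimpleClosed ∧ p.edgeSet ⊂ C := by
  obtain ⟨x, y, p, q, r, hp, hq, -, hpq, -, -, rfl⟩ := h
  refine ⟨x, p, hp, Set.subset_union_left.trans Set.subset_union_left, fun hs ↦ ?_⟩
  obtain ⟨e, he⟩ := List.exists_mem_of_ne_nil _ hq.1
  obtain ⟨u, v, huv⟩ := Walk.exists_isLink he
  exact hpq (Walk.left_mem_support (hs (.inr he)) huv) (Walk.left_mem_support he huv)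

lemma IsTheta.exists_isCycle {C : Set β} (h : IsTheta G C) :
    ∃ (x : α) (p : Walk G x x), p.IsSimpleClosed ∧ p.edgeSet ⊂ C := by
  obtain ⟨x, y, p, hxy, hp, hd, rfl⟩ := h
  have hsub := Set.subset_iUnion fun i ↦ (p i).edgeSet
  obtain ⟨c, hc, hce, -⟩ := Walk.exists_isSimpleClosed_of_isPath hxy (hp 0) (hp 1)
    (hd 0 1 (by decide)).1 (hd 0 1 (by decide)).2
  refine ⟨x, c, hc, ?_, fun hs ↦ ?_⟩
  · rw [hce]
    exact Set.union_subset (hsub 0) (hsub 1)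
  · obtain ⟨e, he⟩ := List.exists_mem_of_ne_nil _ (Walk.edges_ne_nil (p := p 2) hxy)
    have := hs (Set.mem_iUnion.2 ⟨2, he⟩)
    rw [hce] at this
    rcases this with h | h
    · exact (hd 0 2 (by decide)).1 h he
    · exact (hd 1 2 (by decide)).1 h he

lemma IsHandcuffOrTheta.exists_isCycle {C : Set β} (h : IsHandcuffOrTheta G C) :
    ∃ (x : α) (p : Walk G x x), p.IsSimpleClosed ∧ p.edgeSet ⊂ C := by
  rcases h with h | h | h
  · exact h.exists_isCycle
  · exact h.exists_isCycle
  · exact h.exists_isCycle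

lemma IsHandcuffOrTheta.finite_and_subset {C : Set β} (h : IsHandcuffOrTheta G C) :
    C.Finite ∧ C ⊆ G.edgeSet := by
  rcases h with ⟨x, p, q, -, -, -, -, rfl⟩ | ⟨x, y, p, q, r, -, -, -, -, -, -, rfl⟩ |
    ⟨x, y, p, -, -, -, rfl⟩
  · exact ⟨p.finite_edgeSet.union q.finite_edgeSet,
      Set.union_subset p.edgeSet_subset q.edgeSet_subset⟩
  · exact ⟨(p.finite_edgeSet.union r.finite_edgeSet).union q.finite_edgeSet,
      Set.union_subset (Set.union_subset p.edgeSet_subset r.edgeSet_subset) q.edgeSet_subset⟩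
  · exact ⟨Set.finite_iUnion fun i ↦ (p i).finite_edgeSet,
      Set.iUnion_subset fun i ↦ (p i).edgeSet_subset⟩

namespace GainFunction

variable {ψ : GainFunction G Γ}

lemma walkGain_quotient (N : Subgroup Γ) [N.Normal] :
    ∀ {x y : α} (p : Walk G x y), (ψ.quotient N).walkGain p = (ψ.walkGain p : Γ ⧸ N)
  | _, _, .nil _ _ => rfl
  | _, _, .cons e h p => by
    rw [walkGain, walkGain, walkGain_quotient N p]
    rfl

lemma mem_balancedCycles_quotient {N : Subgroup Γ} [N.Normal] {C : Set β} :
    C ∈ (ψ.quotient N).balancedCycles ↔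
      ∃ (x : α) (p : Walk G x x), p.IsSimpleClosed ∧ C = p.edgeSet ∧ ψ.walkGain p ∈ N := by
  simp only [balancedCycles, Set.mem_ofPred_eq, IsBalancedCycle, walkGain_quotient,
    QuotientGroup.eq_one_iff]

/-- Every cycle whose edges lie in `C` has gain outside the subgroup `N`. -/
def NoBalancedCycle (ψ : GainFunction G Γ) (N : Subgroup Γ) (C : Set β) : Prop :=
  ∀ (x : α) (p : Walk G x x), p.IsSimpleClosed → p.edgeSet ⊆ C → ψ.walkGain p ∉ N

lemma isFrameCircuit_quotient_iff {N : Subgroup Γ} [N.Normal] {C : Set β} :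
    IsFrameCircuit G (ψ.quotient N).balancedCycles C ↔
      C ∈ (ψ.quotient N).balancedCycles ∨ (IsHandcuffOrTheta G C ∧ ψ.NoBalancedCycle N C) := by
  refine or_congr_right (and_congr_right fun _ ↦ ⟨fun h x p hp hpC hg ↦ ?_, fun h D hD _ hDb ↦ ?_⟩)
  · exact h _ hpC ⟨x, p, hp, rfl⟩ (mem_balancedCycles_quotient.2 ⟨x, p, hp, rfl, hg⟩)
  · obtain ⟨x, p, hp, rfl, hg⟩ := mem_balancedCycles_quotient.1 hDb
    exact h x p hp hD hg

namespace IsSolMatroid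

variable {N : Subgroup Γ} {S T : Type*} [MulAction Γ S] [MulAction Γ T] {o : T} {F : Matroid β}
  (hF : IsSolMatroid ψ T F) (h : IsFramePair N S T o)
include hF h

lemma isCircuit_of_balanced {x : α} {p : Walk G x x} (hp : p.IsSimpleClosed)
    (hg : ψ.walkGain p ∈ N) : F.IsCircuit p.edgeSet := by
  rw [Matroid.isCircuit_iff_dep_forall_sdiff_singleton_indep]
  refine ⟨?_, fun f hf ↦ ?_⟩
  · obtain ⟨y, e, hl, q, rfl, heq, hq⟩ := hp.exists_eq_cons
    refine hF.dep_of_forall_sat (Walk.edgeSet_subset _) (Walk.finite_edgeSet _)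
      (e := e) (by simp [Walk.edgeSet_cons]) fun t ht ↦ ?_
    rw [sat_iff hl, ht.eq_walkGain_smul q, ← mul_smul]
    · exact (h.smul_of_mem _ hg _).symm
    · rw [Walk.edgeSet_cons]
      exact fun f hf ↦ ⟨.inr hf, fun hfe ↦ heq (hfe ▸ hf)⟩
  · simpa using hF.indep_union_cycle_sdiff h F.empty_indep Set.finite_empty hp
      (fun w _ ht ↦ absurd ht not_touches_empty) hf

/-- Used for handcuffs and theta graphs: an unbalanced cycle avoiding `e` forces the label zero on
its component, in particular at both ends of `e`. -/
lemma dep_of_cons {C X : Set β} (hC : C ⊆ G.edgeSet) (hCf : C.Finite) {e : β} (heC : e ∈ C)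
    (heX : e ∉ X) (hX : X ⊆ C) {x y : α} (hl : G.IsLink e x y)
    (hz : ∀ t : α → T, ψ.IsSol X t → t x = o ∧ t y = o) : F.Dep C := by
  refine hF.dep_of_forall_sat hC hCf heC fun t ht ↦ ?_
  obtain ⟨hx, hy⟩ := hz t (isSol_mono ht fun f hf ↦ ⟨hX hf, fun hfe ↦ heX (hfe ▸ hf)⟩)
  rw [sat_iff hl, hx, hy, h.smul_zero]

lemma dep_of_isTightHandcuff {C : Set β} (hC : IsTightHandcuff G C)
    (hb : ψ.NoBalancedCycle N C) : F.Dep C := by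
  obtain ⟨hCf, hCE⟩ := IsHandcuffOrTheta.finite_and_subset (.inl hC)
  obtain ⟨x, p, q, hp, hq, hpq, -, rfl⟩ := hC
  obtain ⟨y, e, hl, p, rfl, hep, hpp⟩ := hp.exists_eq_cons
  rw [Walk.edgeSet_cons] at *
  refine hF.dep_of_cons h hCE hCf (X := p.edgeSet ∪ q.edgeSet) (by simp) ?_
    (Set.union_subset_union_left _ (Set.subset_insert _ _)) hl fun t ht ↦ ?_
  · rintro (he | he)
    · exact hep he
    · exact hpq (by simp [Walk.edges]) he
  · have hx := h.eq_zero_of_walkGain_notMem ht Set.subset_union_right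
      (hb x q hq Set.subset_union_right)
    exact ⟨hx, h.eq_zero_of_walk ht (p := p) Set.subset_union_left hx⟩

lemma dep_of_isLooseHandcuff {C : Set β} (hC : IsLooseHandcuff G C)
    (hb : ψ.NoBalancedCycle N C) : F.Dep C := by
  obtain ⟨hCf, hCE⟩ := IsHandcuffOrTheta.finite_and_subset (.inr (.inl hC))
  obtain ⟨x, z, p, q, r, hp, hq, hr, hpq, hrp, hrq, rfl⟩ := hC
  obtain ⟨y, e, hl, p, rfl, hep, hpp⟩ := hp.exists_eq_cons
  have hpe := Walk.edgeSet_cons e hl p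
  have hxp : x ∈ (Walk.cons e hl p).support := Walk.start_mem _
  have hyp : y ∈ (Walk.cons e hl p).support := by simp [Walk.support, p.start_mem]
  rw [hpe] at hCf hCE hb ⊢
  refine hF.dep_of_cons h hCE hCf (X := p.edgeSet ∪ r.edgeSet ∪ q.edgeSet) (by simp) ?_
    (by gcongr; exact Set.subset_insert _ _) hl fun t ht ↦ ?_
  · rintro ((he | he) | he)
    · exact hep he
    -- Edge-disjointness of `r` and the first cycle is not part of the definition. A common edge has
    -- both ends on both, so it is a loop, which a path cannot contain.
    · have h1 := hrp x (Walk.left_mem_support he hl) hxp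
      have h2 := hrp y (Walk.right_mem_support he hl) hyp
      subst h2
      rw [hpp.eq_nil] at hep
      obtain ⟨c, d, hcd, a, b, rfl⟩ := r.exists_eq_append_of_mem_edges he
      have hcy : c = y := hrp c (Walk.mem_support_append.2 (.inl a.end_mem))
        (by rcases hcd.left_eq_or_eq hl with rfl | rfl <;> exact hxp)
      have hdy : d = y := hrp d
        (Walk.mem_support_append.2 (.inr (by simp [Walk.support, b.start_mem])))
        (by rcases hcd.right_eq_or_eq hl with rfl | rfl <;> exact hxp)
      have h3 := (Walk.isPath_cons.1 (Walk.isPath_append.1 hr).2.1).1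
      exact h3 (hcy.trans hdy.symm ▸ b.start_mem)
    · exact hpq hxp (Walk.left_mem_support he hl)
  · have hz := h.eq_zero_of_walkGain_notMem ht Set.subset_union_right
      (hb z q hq Set.subset_union_right)
    have hx := h.eq_zero_of_walk ht (p := r)
      (Set.subset_union_right.trans Set.subset_union_left) hz
    exact ⟨hx, h.eq_zero_of_walk ht (p := p)
      (Set.subset_union_left.trans Set.subset_union_left) hx⟩

lemma dep_of_isTheta {C : Set β} (hC : IsTheta G C)
    (hb : ψ.NoBalancedCycle N C) : F.Dep C := by
  obtain ⟨hCf, hCE⟩ := IsHandcuffOrTheta.finite_and_subset (.inr (.inr hC))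
  obtain ⟨x, y, p, hxy, hp, hd, rfl⟩ := hC
  have hsub := Set.subset_iUnion fun i ↦ (p i).edgeSet
  obtain ⟨c, hc, hce, -⟩ := Walk.exists_isSimpleClosed_of_isPath hxy (hp 1) (hp 2)
    (hd 1 2 (by decide)).1 (hd 1 2 (by decide)).2
  have h1 := hb x c hc (by
    rw [hce]; exact Set.union_subset (hsub 1) (hsub 2))
  have hd1 := (hd 0 1 (by decide)).1
  have hd2 := (hd 0 2 (by decide)).1
  have hp0 := hp 0
  have hs0 : (p 0).edgeSet ⊆ ⋃ i, (p i).edgeSet := hsub 0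
  generalize p 0 = p₀ at hd1 hd2 hp0 hs0
  cases p₀ with
  | nil => exact absurd rfl hxy
  | cons e hl p₀ =>
  rw [Walk.edgeSet_cons] at hs0
  simp only [Walk.edges, List.disjoint_cons_left] at hd1 hd2
  refine hF.dep_of_cons h hCE hCf (X := p₀.edgeSet ∪ c.edgeSet) (hs0 (Set.mem_insert _ _)) ?_
    (Set.union_subset ((Set.subset_insert _ _).trans hs0) ?_) hl fun t ht ↦ ?_
  · rintro (he | he)
    · exact (Walk.isPath_cons.1 hp0).1 (Walk.left_mem_support he hl)
    · rw [hce] at he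
      rcases he with he | he
      · exact hd1.1 he
      · exact hd2.1 he
  · rw [hce]; exact Set.union_subset (hsub 1) (hsub 2)
  · have hx := h.eq_zero_of_walkGain_notMem ht Set.subset_union_right h1
    have hy := h.eq_zero_of_walk' ht (p := p 1)
      ((hce ▸ Set.subset_union_left).trans Set.subset_union_right) hx
    exact ⟨hx, h.eq_zero_of_walk ht (p := p₀) Set.subset_union_left hy⟩

lemma indep_sdiff_of_isTightHandcuff {C : Set β} (hC : IsTightHandcuff G C)
    (hb : ψ.NoBalancedCycle N C) {f : β} (hf : f ∈ C) : F.Indep (C \ {f}) := by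
  have key : ∀ (x : α) (p q : Walk G x x), p.IsSimpleClosed → q.IsSimpleClosed →
      (∀ z, z ∈ p.support → z ∈ q.support → z = x) → ψ.walkGain q ∉ N → f ∈ p.edges →
      F.Indep ((p.edgeSet ∪ q.edgeSet) \ {f}) := by
    intro x p q hp hq hs hg hf
    have := hF.indep_union_cycle_sdiff h (hF.indep_cycle h hq hg) q.finite_edgeSet hp
      (fun w hw ht ↦ hs w hw (Walk.mem_support_of_touches ht)) hf
    refine this.subset ?_
    rintro e ⟨he | he, hef⟩
    · exact .inr ⟨he, hef⟩
    · exact .inl he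
  obtain ⟨x, p, q, hp, hq, hpq, hs, rfl⟩ := hC
  rcases hf with hf | hf
  · exact key x p q hp hq hs (hb x q hq Set.subset_union_right) hf
  · rw [Set.union_comm]
    exact key x q p hq hp (fun z h1 h2 ↦ hs z h2 h1) (hb x p hp Set.subset_union_left) hf

lemma indep_sdiff_of_isLooseHandcuff {C : Set β} (hC : IsLooseHandcuff G C)
    (hb : ψ.NoBalancedCycle N C) {f : β} (hf : f ∈ C) : F.Indep (C \ {f}) := by
  have key : ∀ (x y : α) (p : Walk G x x) (q : Walk G y y) (r : Walk G x y), p.IsSimpleClosed →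
      q.IsSimpleClosed → r.IsPath → p.support.Disjoint q.support →
      (∀ z, z ∈ r.support → z ∈ p.support → z = x) →
      (∀ z, z ∈ r.support → z ∈ q.support → z = y) → ψ.walkGain q ∉ N → f ∈ p.edges →
      F.Indep ((p.edgeSet ∪ r.edgeSet ∪ q.edgeSet) \ {f}) := by
    intro x y p q r hp hq hr hpq hrp hrq hg hf
    have i1 := hF.indep_union_path h (hF.indep_cycle h hq hg) q.finite_edgeSet r hr
      (fun w hw ht ↦ hrq w hw (Walk.mem_support_of_touches ht))
    have i2 := hF.indep_union_cycle_sdiff h i1 (q.finite_edgeSet.union r.finite_edgeSet) hp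
      (fun w hw ht ↦ by
        rcases touches_union.1 ht with ht | ht
        · exact absurd (Walk.mem_support_of_touches ht) (hpq hw)
        · exact hrp w (Walk.mem_support_of_touches ht) hw) hf
    refine i2.subset ?_
    rintro e ⟨(he | he) | he, hef⟩
    · exact .inr ⟨he, hef⟩
    · exact .inl (.inr he)
    · exact .inl (.inl he)
  obtain ⟨x, y, p, q, r, hp, hq, hr, hpq, hrp, hrq, rfl⟩ := hC
  have hgp := hb x p hp (Set.subset_union_left.trans Set.subset_union_left)
  have hgq := hb y q hq Set.subset_union_right
  rcases hf with (hf | hf) | hf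
  · exact key x y p q r hp hq hr hpq hrp hrq hgq hf
  -- Removing an edge of the connecting path leaves two unbalanced cycles, each with a pendant path,
  -- which are assembled one at a time.
  · obtain ⟨c, d, hl, a, b, rfl⟩ := r.exists_eq_append_of_mem_edges hf
    obtain ⟨ha, hb', hab⟩ := Walk.isPath_append.1 hr
    obtain ⟨hcb, hb'⟩ := Walk.isPath_cons.1 hb'
    have hab' : ∀ w ∈ a.support, w ∉ b.support := fun w hw hw' ↦
      hcb (hab w hw (by simp [Walk.support, hw']) ▸ hw')
    have har : ∀ w ∈ a.support, w ∈ (a.append (.cons f hl b)).support :=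
      fun w hw ↦ Walk.mem_support_append.2 (.inl hw)
    have hbr : ∀ w ∈ b.support, w ∈ (a.append (.cons f hl b)).support :=
      fun w hw ↦ Walk.mem_support_append.2 (.inr (by simp [Walk.support, hw]))
    have i1 := hF.indep_union_path h (hF.indep_cycle h hp hgp) p.finite_edgeSet a.reverse
      ha.reverse (fun w hw ht ↦ hrp w (har w (by simpa using hw)) (Walk.mem_support_of_touches ht))
    have i2 := hF.indep_union_cycle h i1 (p.finite_edgeSet.union a.reverse.finite_edgeSet) hq hgq
      (fun w hw ht ↦ by
        rcases touches_union.1 ht with ht | ht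
        · exact hpq (Walk.mem_support_of_touches ht) hw
        · rw [Walk.edgeSet_reverse] at ht
          have hwa := Walk.mem_support_of_touches ht
          have := hrq w (har w hwa) hw
          subst this
          exact hab' w hwa b.end_mem)
    have i3 := hF.indep_union_path h i2
      ((p.finite_edgeSet.union a.reverse.finite_edgeSet).union q.finite_edgeSet) b hb'
      (fun w hw ht ↦ by
        rcases touches_union.1 ht with ht | ht
        · rcases touches_union.1 ht with ht | ht
          · have := hrp w (hbr w hw) (Walk.mem_support_of_touches ht)
            subst this
            exact absurd hw (hab' w a.start_mem)
          · rw [Walk.edgeSet_reverse] at ht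
            exact absurd hw (hab' w (Walk.mem_support_of_touches ht))
        · exact hrq w (hbr w hw) (Walk.mem_support_of_touches ht))
    refine i3.subset ?_
    rw [Walk.edgeSet_append, Walk.edgeSet_cons, Walk.edgeSet_reverse]
    rintro e ⟨(he | he | he | he) | he, hef⟩
    · exact .inl (.inl (.inl he))
    · exact .inl (.inl (.inr he))
    · exact absurd he hef
    · exact .inr he
    · exact .inl (.inr he)
  · have := key y x q p r.reverse hq hp hr.reverse hpq.symm (by simpa using hrq)
      (by simpa using hrp) hgp hf
    rw [Walk.edgeSet_reverse] at this
    convert this using 2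
    rw [Set.union_comm, Set.union_comm p.edgeSet, Set.union_assoc]

lemma indep_sdiff_of_isTheta {C : Set β} (hC : IsTheta G C)
    (hb : ψ.NoBalancedCycle N C) {f : β} (hf : f ∈ C) : F.Indep (C \ {f}) := by
  obtain ⟨x, y, p, hxy, hp, hd, rfl⟩ := hC
  have hsub := Set.subset_iUnion fun i ↦ (p i).edgeSet
  obtain ⟨i, hf⟩ := Set.mem_iUnion.1 hf
  obtain ⟨j, k, hij, hik, hjk, hall⟩ : ∃ j k : Fin 3, i ≠ j ∧ i ≠ k ∧ j ≠ k ∧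
      ∀ l, l = i ∨ l = j ∨ l = k := by
    clear hf
    decide +revert
  obtain ⟨c, hc, hce, hcs⟩ := Walk.exists_isSimpleClosed_of_isPath hxy (hp j) (hp k)
    (hd j k hjk).1 (hd j k hjk).2
  have h1 := hb x c hc (by
    rw [hce]; exact Set.union_subset (hsub j) (hsub k))
  have i1 := hF.indep_union_path_sdiff h (hF.indep_cycle h hc h1) c.finite_edgeSet (hp i)
    (fun w hw ht ↦ by
      rcases (hcs w).1 (Walk.mem_support_of_touches ht) with hw' | hw'
      · exact (hd i j hij).2 w hw hw'
      · exact (hd i k hik).2 w hw hw') hf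
  refine i1.subset ?_
  rintro e ⟨he, hef⟩
  obtain ⟨l, hl⟩ := Set.mem_iUnion.1 he
  rw [hce]
  rcases hall l with rfl | rfl | rfl
  · exact .inr ⟨hl, hef⟩
  · exact .inl (.inl hl)
  · exact .inl (.inr hl)

lemma isCircuit_of_isHandcuffOrTheta {C : Set β} (hC : IsHandcuffOrTheta G C)
    (hb : ψ.NoBalancedCycle N C) : F.IsCircuit C := by
  rw [Matroid.isCircuit_iff_dep_forall_sdiff_singleton_indep]
  rcases hC with hC | hC | hC
  · exact ⟨hF.dep_of_isTightHandcuff h hC hb,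
      fun f hf ↦ hF.indep_sdiff_of_isTightHandcuff h hC hb hf⟩
  · exact ⟨hF.dep_of_isLooseHandcuff h hC hb,
      fun f hf ↦ hF.indep_sdiff_of_isLooseHandcuff h hC hb hf⟩
  · exact ⟨hF.dep_of_isTheta h hC hb, fun f hf ↦ hF.indep_sdiff_of_isTheta h hC hb hf⟩

/-! ### Circuits of the matroid are frame circuits -/

/-- Both ends of an edge of a circuit meet another edge of the circuit, unless it is a loop. -/
lemma exists_ne_of_isCircuit {C : Set β} (hC : F.IsCircuit C) {e : β} (he : e ∈ C) {u v : α}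
    (huv : G.IsLink e u v) (hne : u ≠ v) : ∃ f ∈ C, f ≠ e ∧ ∃ w, G.IsLink f u w := by
  have := hF.finitary
  by_contra! hc
  have hi := hF.indep_insert_of_not_touches h (hC.sdiff_singleton_indep he) hC.finite.sdiff huv hne
    (fun ⟨f, hf, w, hl⟩ ↦ hc f hf.1 hf.2 w hl)
  rw [Set.insert_sdiff_singleton, Set.insert_eq_of_mem he] at hi
  exact hC.not_indep hi

/-- A circuit is connected. -/
lemma left_mem_of_isCircuit {C : Set β} (hC : F.IsCircuit C) {U : Set α}
    (hU : ∀ f ∈ C, ∀ a b, G.IsLink f a b → a ∈ U → b ∈ U) {e : β} (he : e ∈ C) {u v : α}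
    (huv : G.IsLink e u v) (hu : u ∈ U) {g : β} (hg : g ∈ C) {a b : α} (hab : G.IsLink g a b) :
    a ∈ U := by
  classical
  have := hF.finitary
  by_contra ha
  -- If `D` were a proper part of the circuit, it would be independent; a labelling violating only
  -- `e` in `D`, extended by zero outside `U`, would violate only `e` in `C`.
  set D : Set β := {f ∈ C | ∃ a b, G.IsLink f a b ∧ a ∈ U} with hD
  have hgD : g ∉ D := by
    rintro ⟨-, a', b', hab', ha'⟩
    have hb' := hU g hg _ _ hab' ha'
    rcases hab.left_eq_or_eq hab' with rfl | rfl
    · exact ha ha'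
    · exact ha hb'
  have hDi : F.Indep D := hC.ssubset_indep ⟨fun f hf ↦ hf.1, fun hs ↦ hgD (hs hg)⟩
  obtain ⟨t, ht, hte⟩ := hF.exists_isSol_of_indep hDi (hC.finite.subset fun f hf ↦ hf.1)
    (e := e) ⟨he, u, v, huv, hu⟩
  have hsat : ψ.Sat (fun a ↦ if a ∈ U then t a else o) e := by
    refine hF.sat_of_isCircuit hC he fun f hf c d hcd ↦ ?_
    by_cases hc : c ∈ U
    · have hd := hU f hf.1 _ _ hcd hc
      simp only [hc, hd, if_true]
      exact ht f ⟨⟨hf.1, c, d, hcd, hc⟩, hf.2⟩ _ _ hcd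
    · have hd : d ∉ U := fun hd ↦ hc (hU f hf.1 _ _ hcd.symm hd)
      simp only [hc, hd, if_false, h.smul_zero]
  have hv := hU e he _ _ huv hu
  rw [sat_iff huv] at hte hsat
  simp only [hu, hv, if_true] at hsat
  exact hte hsat

lemma exists_cycle_of_isCircuit {C : Set β} (hC : F.IsCircuit C) :
    ∃ (x : α) (p : Walk G x x), p.IsSimpleClosed ∧ p.edgeSet ⊆ C := by
  have := hF.finitary
  obtain ⟨e, he⟩ := hC.nonempty
  obtain ⟨u, v, huv⟩ := Graph.exists_isLink_of_mem_edgeSet (hF.ground_eq ▸ hC.subset_ground he)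
  rcases eq_or_ne u v with rfl | hne
  · refine ⟨u, .cons e huv (.nil u huv.left_mem), Walk.isSimpleClosed_cons.2
      ⟨by simp [Walk.edges], by simp [Walk.IsPath, Walk.support]⟩, ?_⟩
    simpa [Walk.edgeSet, Walk.edges] using he
  -- With `W` empty there is no ear, so a cycle is found.
  · rcases Walk.exists_ear_or_lollipop hC.finite (W := ∅)
      (fun e he y z hl _ hne ↦ hF.exists_ne_of_isCircuit h hC he hl hne) _ e huv
      (.nil v huv.right_mem) rfl (by simp [Walk.IsPath, Walk.support, hne])
      (by simpa [Walk.edgeSet, Walk.edges] using he) (by simp) with ⟨z, hz, -⟩ | h'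
    · exact absurd hz (Set.notMem_empty z)
    · obtain ⟨z, b, q, hq, -, hqC, -⟩ := h'
      exact ⟨z, q, hq, hqC⟩

lemma exists_isHandcuffOrTheta_of_isCircuit {C : Set β} (hC : F.IsCircuit C)
    (hb : ψ.NoBalancedCycle N C) : ∃ D ⊆ C, IsHandcuffOrTheta G D := by
  have := hF.finitary
  obtain ⟨w₀, p, hp, hpC⟩ := hF.exists_cycle_of_isCircuit h hC
  have hpi := hF.indep_cycle h hp (hb w₀ p hp hpC)
  -- The unbalanced cycle `p` is independent, so it is not all of `C`; by connectedness another edge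
  -- of `C` meets it. Following this edge gives a theta graph if the path returns to `p` elsewhere,
  -- and a handcuff otherwise.
  obtain ⟨f, hfC, hfp, x, z, hf, hx⟩ : ∃ f ∈ C, f ∉ p.edgeSet ∧ ∃ x z, G.IsLink f x z ∧
      x ∈ p.support := by
    by_contra! hc
    refine hC.not_indep (hpi.subset fun g hg ↦ ?_)
    by_contra hgp
    obtain ⟨e, he⟩ := List.exists_mem_of_ne_nil _ hp.1
    obtain ⟨u, v, huv⟩ := Walk.exists_isLink he
    obtain ⟨a, b, hab⟩ := Graph.exists_isLink_of_mem_edgeSet (hF.ground_eq ▸ hC.subset_ground hg)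
    refine hc g hg hgp a b hab (hF.left_mem_of_isCircuit h hC (U := {a | a ∈ p.support}) ?_ (hpC he)
      huv (Walk.left_mem_support he huv) hg hab)
    intro g' hg' c d hcd hcp
    by_cases hg'p : g' ∈ p.edgeSet
    · exact Walk.right_mem_support hg'p hcd
    · exact absurd hcp (hc g' hg' hg'p c d hcd)
  obtain ⟨p', hp', he', hs'⟩ := Walk.exists_rotate hp hx
  rw [← he'] at hpC hfp
  rw [← hs'] at hx
  clear hpi hs' he' hp
  rename' p => p₀, p' => p
  clear p₀
  by_cases hz : z ∈ p.support
  · rcases eq_or_ne z x with rfl | hzx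
    · refine ⟨p.edgeSet ∪ {f}, Set.union_subset hpC (by simpa), .inl ⟨z, p,
        .cons f hf (.nil z hf.left_mem), hp', Walk.isSimpleClosed_cons.2 ⟨by simp [Walk.edges],
        by simp [Walk.IsPath, Walk.support]⟩, ?_, ?_, ?_⟩⟩
      · simpa [Walk.edges, Walk.edgeSet] using hfp
      · simp [Walk.support]
      · simp [Walk.edgeSet, Walk.edges]
    · refine ⟨_, ?_, .inr (.inr (Walk.isTheta_of_isPath hp' hz hzx
        (r := .cons f hf (.nil z hf.right_mem)) ?_ ?_ ?_))⟩
      · refine Set.union_subset hpC ?_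
        simpa [Walk.edgeSet, Walk.edges] using hfC
      · simp [Walk.IsPath, Walk.support, hzx.symm]
      · simpa [Walk.edges, Walk.edgeSet] using hfp
      · simp [Walk.support]
  have hzx : z ≠ x := fun hzx ↦ hz (hzx ▸ hx)
  rcases Walk.exists_ear_or_lollipop (X := C \ p.edgeSet) hC.finite.sdiff (W := {a | a ∈ p.support})
      (fun e he y z hl hy hne ↦ by
        obtain ⟨g, hg, hge, w, hgw⟩ := hF.exists_ne_of_isCircuit h hC he.1 hl hne
        exact ⟨g, ⟨hg, fun hgp ↦ hy (Walk.left_mem_support hgp hgw)⟩, hge, w, hgw⟩) _ f hf.symm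
      (.nil x hf.left_mem) rfl (by simp [Walk.IsPath, Walk.support, hzx])
      (by simpa [Walk.edgeSet, Walk.edges] using ⟨hfC, hfp⟩)
      (by
        simp only [Walk.support, List.mem_cons, List.not_mem_nil, or_false]
        rintro w (rfl | rfl) hw
        · exact absurd hw hz
        · rfl) with
    ⟨y, hy, hyx, r, hr, hrC, hrp⟩ | ⟨y, b, q, hq, hbp, hqC, hbC, hbp', hqp, hbq⟩
  · refine ⟨_, ?_, .inr (.inr (Walk.isTheta_of_isPath hp' hy hyx hr.reverse ?_ ?_))⟩
    · rw [Walk.edgeSet_reverse]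
      exact Set.union_subset hpC (hrC.trans Set.sdiff_subset)
    · intro e he he'
      exact (hrC (by simpa [Walk.edgeSet] using he)).2 he'
    · intro w hw hwp
      exact (hrp w (by simpa using hw) hwp).symm
  · have hqp' : p.edges.Disjoint q.edges := fun e he he' ↦ (hqC he').2 he
    rcases eq_or_ne y x with rfl | hyx
    · exact ⟨_, Set.union_subset hpC (hqC.trans Set.sdiff_subset), .inl ⟨y, p, q, hp', hq, hqp',
        fun w hw hw' ↦ hqp w hw' hw, rfl⟩⟩
    · refine ⟨_, Set.union_subset (Set.union_subset hpC ?_) (hqC.trans Set.sdiff_subset),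
        .inr (.inl ⟨x, y, p, q, b.reverse, hp', hq, hbp.reverse, ?_, ?_, ?_, rfl⟩)⟩
      · rw [Walk.edgeSet_reverse]
        exact hbC.trans Set.sdiff_subset
      · intro w hw hw'
        have hwx := hqp w hw' hw
        subst hwx
        exact hyx (hbq w b.end_mem hw').symm
      · exact fun w hw hwp ↦ hbp' w (by simpa using hw) hwp
      · exact fun w hw hwq ↦ hbq w (by simpa using hw) hwq

lemma isCircuit_iff [N.Normal] {C : Set β} :
    F.IsCircuit C ↔ IsFrameCircuit G (ψ.quotient N).balancedCycles C := by
  rw [isFrameCircuit_quotient_iff]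
  constructor
  · intro hC
    by_cases hb : ψ.NoBalancedCycle N C
    · obtain ⟨D, hDC, hD⟩ := hF.exists_isHandcuffOrTheta_of_isCircuit h hC hb
      have := hF.isCircuit_of_isHandcuffOrTheta h hD (fun x p hp hpD ↦ hb x p hp (hpD.trans hDC))
      rw [← this.eq_of_subset_isCircuit hC hDC] at hb ⊢
      exact .inr ⟨hD, hb⟩
    · unfold NoBalancedCycle at hb
      push Not at hb
      obtain ⟨x, p, hp, hpC, hg⟩ := hb
      have := (hF.isCircuit_of_balanced h hp hg).eq_of_subset_isCircuit hC hpC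
      exact .inl (mem_balancedCycles_quotient.2 ⟨x, p, hp, this.symm, hg⟩)
  · rintro (hC | ⟨hC, hb⟩)
    · obtain ⟨x, p, hp, rfl, hg⟩ := mem_balancedCycles_quotient.1 hC
      exact hF.isCircuit_of_balanced h hp hg
    · exact hF.isCircuit_of_isHandcuffOrTheta h hC hb

end IsSolMatroid

end GainFunction

/-! ### The `Γ`-sets of a Frobenius partition -/

section Group

variable {Γ₁ : Subgroup Γ} {𝒜 : Set (Subgroup Γ)}

lemma IsMalnormal.map_conj_eq_iff {A : Subgroup Γ} (hA : IsMalnormal A) (hne : A ≠ ⊥) {g : Γ} :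
    A.map (MulAut.conj g).toMonoidHom = A ↔ g ∈ A := by
  constructor
  · intro h
    by_contra hg
    have := hA g⁻¹ (fun h ↦ hg (by simpa using h))
    rw [inv_inv, h, inf_idem] at this
    exact hne this
  · intro hg
    ext a
    simp only [Subgroup.mem_map, MulEquiv.coe_toMonoidHom, MulAut.conj_apply]
    constructor
    · rintro ⟨b, hb, rfl⟩
      exact A.mul_mem (A.mul_mem hg hb) (A.inv_mem hg)
    · intro ha
      exact ⟨g⁻¹ * a * g, A.mul_mem (A.mul_mem (A.inv_mem hg) ha) hg, by group⟩

lemma IsFrobeniusPartition.eq_one_of_mem (h : IsFrobeniusPartition Γ₁ 𝒜) {A B : Subgroup Γ}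
    (hA : A ∈ insert Γ₁ 𝒜) (hB : B ∈ insert Γ₁ 𝒜) (hAB : A ≠ B) {g : Γ} (hgA : g ∈ A)
    (hgB : g ∈ B) : g = 1 := by
  by_contra hg
  exact hAB ((h.partition g hg).unique ⟨hA, hgA⟩ ⟨hB, hgB⟩)

/-- The action of the group by conjugation on the nontrivial complements in a Frobenius
partition. -/
abbrev IsFrobeniusPartition.mulAction (h : IsFrobeniusPartition Γ₁ 𝒜) :
    MulAction Γ {A : Subgroup Γ // A ∈ 𝒜 ∧ A ≠ ⊥ ∧ A ≠ Γ₁} where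
  smul g A := ⟨A.1.map (MulAut.conj g).toMonoidHom, h.conj_mem _ A.2.1 g, by
    rw [Ne, Subgroup.map_eq_bot_iff_of_injective _ (MulAut.conj g).injective]
    exact A.2.2.1, by
    intro hA
    refine A.2.2.2 (Subgroup.map_injective (MulAut.conj g).injective (hA.trans ?_))
    have := h.normal
    exact (Subgroup.Normal.map_conj_eq Γ₁ g).symm⟩
  one_smul A := Subtype.ext (by
    change A.1.map (MulAut.conj 1).toMonoidHom = A.1
    ext; simp)
  mul_smul g g' A := Subtype.ext (by
    change A.1.map (MulAut.conj (g * g')).toMonoidHom =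
      (A.1.map (MulAut.conj g').toMonoidHom).map (MulAut.conj g).toMonoidHom
    rw [Subgroup.map_map, map_mul]
    rfl)

/-- The `Γ`-sets belonging to a Frobenius partition: the complements, enlarged by two free orbits,
and the quotient group, enlarged by a zero. -/
lemma IsFrobeniusPartition.exists_isFramePair [Γ₁.Normal] (h : IsFrobeniusPartition Γ₁ 𝒜) :
    ∃ (S : Type w) (_ : MulAction Γ S),
      GainFunction.IsFramePair Γ₁ S (Option (Γ ⧸ Γ₁)) none ∧
      (∀ s : S, MulAction.stabilizer Γ s ≠ ⊥ → MulAction.stabilizer Γ s ∈ 𝒜) ∧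
      ∀ A ∈ 𝒜, A ≠ ⊥ → A ≠ Γ₁ → ∃ s : S, A ≤ MulAction.stabilizer Γ s := by
  let := h.mulAction
  have hfix : ∀ (g : Γ) (A : {A : Subgroup Γ // A ∈ 𝒜 ∧ A ≠ ⊥ ∧ A ≠ Γ₁}),
      g • A = A ↔ g ∈ A.1 := by
    intro g A
    rw [← (h.malnormal A.1 A.2.1).map_conj_eq_iff A.2.2.1]
    exact Subtype.ext_iff
  have hquot : ∀ (g : Γ) (q : Γ ⧸ Γ₁), g • q = q ↔ g ∈ Γ₁ := by
    intro g q
    induction q using QuotientGroup.induction_on with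
    | H a =>
      change ((g * a : Γ) : Γ ⧸ Γ₁) = a ↔ _
      rw [QuotientGroup.mk_mul, mul_eq_right, QuotientGroup.eq_one_iff]
  -- Two free orbits ensure that there are two distinct points even if `Γ` is trivial. The subgroups
  -- `⊥` and `Γ₁`, which `𝒜` may contain, are left out: both are normal, so every element would fix
  -- them.
  refine ⟨(Γ ⊕ Γ) ⊕ {A : Subgroup Γ // A ∈ 𝒜 ∧ A ≠ ⊥ ∧ A ≠ Γ₁}, inferInstance,
    ⟨fun g ↦ rfl, ?_, ?_, ?_, ?_, ?_, ?_, ?_⟩, ?_, ?_⟩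
  · rintro g hg (_ | q)
    · rfl
    · exact congrArg some ((hquot g q).2 hg)
  · rintro g (_ | q) hq hg
    · exact absurd rfl hq
    · exact (hquot g q).1 (Option.some_injective _ hg)
  · exact ⟨some 1, by simp⟩
  · exact ⟨.inl (.inl 1), .inl (.inr 1), by simp⟩
  · rintro g hg ((a | a) | A) hs
    · simpa using hs
    · simpa using hs
    · have hgA := (hfix g A).1 (Sum.inr_injective hs)
      exact h.eq_one_of_mem (.inl rfl) (.inr A.2.1) A.2.2.2.symm hg hgA
  · rintro g ((a | a) | A) t hst hs ht
    · simpa using hs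
    · simpa using hs
    · obtain (a | a) | B := t
      · simpa using ht
      · simpa using ht
      · refine h.eq_one_of_mem (.inr A.2.1) (.inr B.2.1) ?_ ((hfix g A).1 (Sum.inr_injective hs))
          ((hfix g B).1 (Sum.inr_injective ht))
        exact fun hAB ↦ hst (congrArg _ (Subtype.ext hAB))
  · intro g hg
    have hg1 : g ≠ 1 := fun h1 ↦ hg (h1 ▸ Γ₁.one_mem)
    obtain ⟨A, ⟨hA, hgA⟩, -⟩ := h.partition g hg1
    have hA1 : A ≠ Γ₁ := fun hA1 ↦ hg (hA1 ▸ hgA)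
    have hA0 : A ≠ ⊥ := fun hA0 ↦ hg1 (by simpa [hA0] using hgA)
    exact ⟨.inr ⟨A, hA.resolve_left hA1, hA0, hA1⟩, congrArg Sum.inr ((hfix g _).2 hgA)⟩
  · rintro ((a | a) | A) hs
    · refine absurd ((Subgroup.eq_bot_iff_forall _).2 fun g hg ↦ ?_) hs
      simpa using MulAction.mem_stabilizer_iff.1 hg
    · refine absurd ((Subgroup.eq_bot_iff_forall _).2 fun g hg ↦ ?_) hs
      simpa using MulAction.mem_stabilizer_iff.1 hg
    · convert A.2.1 using 1
      ext g
      rw [MulAction.mem_stabilizer_iff, ← hfix g A]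
      exact Sum.inr_injective.eq_iff
  · intro A hA hA0 hA1
    refine ⟨.inr ⟨A, hA, hA0, hA1⟩, fun g hg ↦ ?_⟩
    exact congrArg Sum.inr ((hfix g ⟨A, hA, hA0, hA1⟩).2 hg)

end Group

/-! ### The linear class as the circuits solvable in `S` -/

namespace GainFunction

variable {ψ : GainFunction G Γ}

lemma walkGain_switch (η : α → Γ) : ∀ {x y : α} (p : Walk G x y),
    (ψ.switch η).walkGain p = (η x)⁻¹ * ψ.walkGain p * η y
  | _, _, .nil _ _ => by simp [walkGain]
  | _, _, .cons e h p => by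
    rw [walkGain, walkGain, walkGain_switch η p]
    simp only [switch]
    group

lemma walkGain_mem {A : Subgroup Γ} {C : Set β} (hA : ψ.values C ⊆ A) : ∀ {x y : α}
    (p : Walk G x y), p.edgeSet ⊆ C → ψ.walkGain p ∈ A
  | _, _, .nil _ _, _ => A.one_mem
  | _, _, .cons e h p, hp => by
    rw [Walk.edgeSet_cons, Set.insert_subset_iff] at hp
    exact A.mul_mem (hA ⟨e, hp.1, _, _, h, rfl⟩) (walkGain_mem hA p hp.2)

lemma exists_isSol_of_isBalancedCycle {P : Type*} [MulAction Γ P] [Nonempty P] {C : Set β}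
    (hC : ψ.IsBalancedCycle C) : ∃ x : α → P, ψ.IsSol C x := by
  obtain ⟨x, p, hp, rfl, hg⟩ := hC
  obtain ⟨y, e, hl, q, rfl, heq, hq⟩ := hp.exists_eq_cons
  obtain ⟨s⟩ := ‹Nonempty P›
  obtain ⟨t, ht, -⟩ := exists_isSol_path ψ (fun _ ↦ s) s q hq
  refine ⟨t, ?_⟩
  rw [Walk.edgeSet_cons, isSol_insert, sat_iff hl, ht.eq_walkGain_smul q subset_rfl, ← mul_smul]
  refine ⟨?_, ht⟩
  rw [walkGain] at hg
  rw [hg, one_smul]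

variable {N : Subgroup Γ} [N.Normal] {𝒜 : Set (Subgroup Γ)} {S T : Type*} [MulAction Γ S]
  [MulAction Γ T] {o : T} {F : Matroid β}

lemma mem_linearClass_iff (hF : IsSolMatroid ψ T F) (h : IsFramePair N S T o)
    (hS : ∀ s : S, MulAction.stabilizer Γ s ≠ ⊥ → MulAction.stabilizer Γ s ∈ 𝒜)
    (h𝒜 : ∀ A ∈ 𝒜, A ≠ ⊥ → A ≠ N → ∃ s : S, A ≤ MulAction.stabilizer Γ s) {C : Set β} :
    C ∈ linearClass N 𝒜 ψ ↔ F.IsCircuit C ∧ ∃ x : α → S, ψ.IsSol C x := by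
  classical
  unfold linearClass
  rw [Set.mem_ofPred_eq, ← hF.isCircuit_iff h]
  refine and_congr_right fun hC ↦ ⟨?_, ?_⟩
  · rintro (hb | ⟨hCt, η, A, hA, hη⟩)
    · obtain ⟨s, -⟩ := h.nontrivial
      have : Nonempty S := ⟨s⟩
      exact exists_isSol_of_isBalancedCycle hb
    · obtain ⟨x, p, hp, hpC⟩ := hCt.exists_isCycle
      -- A balanced cycle would be a circuit properly inside `C`. So `A` contains the gain of this
      -- cycle after switching, which is outside `N`, and hence `A` fixes a point of `S`.
      have hg : ψ.walkGain p ∉ N := fun hg ↦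
        hC.not_ssubset (hF.isCircuit_of_balanced h hp hg) hpC
      have hgA := walkGain_mem hη p hpC.subset
      have hgN : (ψ.switch η).walkGain p ∉ N := by
        rw [walkGain_switch]
        intro hc
        refine hg ?_
        have := ‹N.Normal›.conj_mem _ hc (η x)
        simpa [mul_assoc] using this
      obtain ⟨s, hs⟩ := h𝒜 A hA (fun hA0 ↦ hgN (by
        rw [hA0, Subgroup.mem_bot] at hgA
        exact hgA ▸ N.one_mem)) (fun hAN ↦ hgN (hAN ▸ hgA))
      refine ⟨fun v ↦ η v • s, fun e he u v huv ↦ ?_⟩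
      have := hs (hη ⟨e, he, u, v, huv, rfl⟩)
      rw [MulAction.mem_stabilizer_iff, switch, mul_smul, mul_smul, inv_smul_eq_iff] at this
      exact this.symm
  · rintro ⟨x, hx⟩
    rcases isFrameCircuit_quotient_iff.1 ((hF.isCircuit_iff h).1 hC) with hb | ⟨hCt, hb⟩
    · obtain ⟨w, p, hp, rfl, hg⟩ := mem_balancedCycles_quotient.1 hb
      exact .inl ⟨w, p, hp, rfl, h.eq_one_of_mem _ hg (x w) (hx.eq_walkGain_smul p subset_rfl).symm⟩
    · obtain ⟨w, p, hp, hpC⟩ := hCt.exists_isCycle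
      have hg := hb w p hp hpC.subset
      have hst : MulAction.stabilizer Γ (x w) ∈ 𝒜 := by
        refine hS _ fun hbot ↦ hg ?_
        have : ψ.walkGain p ∈ MulAction.stabilizer Γ (x w) :=
          MulAction.mem_stabilizer_iff.2 (hx.eq_walkGain_smul p hpC.subset).symm
        rw [hbot, Subgroup.mem_bot] at this
        exact this ▸ N.one_mem
      obtain ⟨y, e, hl, q, rfl, -⟩ := hp.exists_eq_cons
      -- As circuits are connected, all labels at ends of edges of `C` lie in the orbit of `x w`.
      have hU : ∀ f ∈ C, ∀ a b, G.IsLink f a b → ∃ g : Γ, x a = g • x w := by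
        intro f hf a b hab
        refine hF.left_mem_of_isCircuit h hC (U := {a | ∃ g : Γ, x a = g • x w}) ?_
          (hpC.subset (by simp [Walk.edgeSet_cons])) hl ⟨1, by simp⟩ hf hab
        rintro f hf a b hab ⟨g, hg⟩
        refine ⟨ψ.gain f b a * g, ?_⟩
        rw [mul_smul, ← hg]
        exact hx f hf b a hab.symm
      -- Switching by `η` makes the label `x w` constant on `C`, so the switched gains stabilize it.
      -- The default `1` is never used at an end of an edge of `C`.
      set η : α → Γ := fun a ↦ if ha : ∃ g : Γ, x a = g • x w then ha.choose else 1 with hη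
      have hηx : ∀ f ∈ C, ∀ a b, G.IsLink f a b → x a = η a • x w := by
        intro f hf a b hab
        have ha := hU f hf a b hab
        simp only [hη, dif_pos ha]
        exact ha.choose_spec
      refine .inr ⟨hCt, η, _, hst, ?_⟩
      rintro g ⟨f, hf, a, b, hab, rfl⟩
      rw [SetLike.mem_coe, MulAction.mem_stabilizer_iff, switch, mul_smul, mul_smul,
        inv_smul_eq_iff, ← hηx f hf a b hab, ← hηx f hf b a hab.symm]
      exact (hx f hf a b hab).symm

end GainFunction

end GainGraph

theorem theorem1 {α : Type*} {β : Type*} {Γ : Type*} [Group Γ]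
    (Γ₁ : Subgroup Γ) [Γ₁.Normal] (𝒜 : Set (Subgroup Γ))
    (h𝒜 : GainGraph.IsFrobeniusPartition Γ₁ 𝒜)
    (G : Graph α β) (ψ : GainGraph.GainFunction G Γ) :
    ∃ F : Matroid β, GainGraph.IsFrameMatroid (ψ.quotient Γ₁) F ∧
      GainGraph.IsLinearClass F (GainGraph.linearClass Γ₁ 𝒜 ψ) ∧
      ∃ M : Matroid β, GainGraph.IsLiftAlong F (GainGraph.linearClass Γ₁ 𝒜 ψ) M ∧
        GainGraph.IsElementaryLift M F ∧
        ∀ M' : Matroid β,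
          GainGraph.IsLiftAlong F (GainGraph.linearClass Γ₁ 𝒜 ψ) M' → M' = M := by
  obtain ⟨S, _, h, hS, hA⟩ := h𝒜.exists_isFramePair
  obtain ⟨K, hK, hnone, hE, hcl, hclS⟩ := h.exists_matroid ψ
  have hF : ψ.IsSolMatroid (Option (Γ ⧸ Γ₁)) K.contractNone :=
    ⟨Matroid.contractNone_finitary, hE, hcl⟩
  have h𝒞 : ∀ C, C ∈ GainGraph.linearClass Γ₁ 𝒜 ψ ↔
      K.contractNone.IsCircuit C ∧ none ∉ K.closure (some '' C) := by
    intro C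
    rw [GainGraph.GainFunction.mem_linearClass_iff hF h hS hA]
    refine and_congr_right fun hC ↦ ?_
    have := hF.finitary
    rw [hclS C (hE ▸ hC.subset_ground) hC.finite]
    push Not
    rfl
  have hM := Matroid.isLiftAlong_deleteNone hnone h𝒞
  exact ⟨K.contractNone, ⟨hE, fun C ↦ hF.isCircuit_iff h⟩,
    Matroid.isLinearClass_contractNone hnone h𝒞, K.deleteNone, hM,
    Matroid.isElementaryLift_deleteNone hnone, fun M' hM' ↦ Matroid.IsLiftAlong.unique hM hM'⟩
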